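/- Let $b=(b_1\ge b_2\ge\dots\ge b_\ell\ge 1)$ be an integer partition, let $b'$ be its conjugate partition, $b'_i=\#\{j: b_j\ge i\}$, and let $B$ be the Ferrers board with row lengths $b_1,b_2,\dots$ (left-justified rows), so that its column lengths are $b'_1,b'_2,\dots$. For an integer $k\ge 2$ let $r_B(k)$ be the number of ways of choosing $k$ squares of $B$ no two of which lie in the same row or in the same column, and let $f_B(k)$ be the number of ways of choosing $k$ squares of $B$ no two of which lie in the same column. Put $$N=\sum_i b_i,\qquad L=\sum_i\binom{b_i}{2},\qquad L'=\sum_i\binom{b'_i}{2},\qquad \lambda=\frac{\binom k2 L}{\binom N2},\qquad \lambda'=\frac{\binom k2 L'}{\binom N2},$$ $$s_0=\frac{L}{\binom N2},\quad s_0'=\frac{L'}{\binom N2},\quad s_1=\frac{2(k-2)L}{\binom N2},\quad s_1'=\frac{2(k-2)L'}{\binom N2},$$ $$s_2=(k-2)\sum_i\binom{b_i}{2}\frac{b_i-2}{N-2},\qquad s_2'=(k-2)\sum_i\binom{b'_i}{2}\frac{b'_i-2}{N-2},$$ $$s_3=(k-2)\sum_i\ \sum_{1\le c_1<c_2\le b_i}\left[\frac{b'_{c_1}-1}{N-2}+\frac{b'_{c_2}-1}{N-2}\right],\qquad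 s_3'=(k-2)\sum_i\ \sum_{1\le c_1<c_2\le b'_i}\left[\frac{b_{c_1}-1}{N-2}+\frac{b_{c_2}-1}{N-2}\right],$$ $$s_4=\frac{13-12k+3k^2}{\binom N2},$$ $$d_3=s_0+s_0'+s_1+s_1'+\frac{s_2+s_2'+s_3+s_3'}{L+L'}+s_4,\qquad d_4=s_0'+s_1'+\frac{s_2'+s_3'}{L'}+s_4,$$ $$R_{n,k}=\min\bigl(d_3,(\lambda+\lambda')d_3,1\bigr),\qquad F_{n,k}=\min\bigl(d_4,\lambda' d_4,1\bigr),$$ where in degenerate cases (boards with at most one row, or with $N\le 2$) a quotient with denominator $0$ is read as $0$. Then $$\binom Nk e^{-(\lambda+\lambda')}\left(1-e^{\lambda+\lambda'}R_{n,k}\right)\le r_B(k)\le \binom Nk e^{-(\lambda+\lambda')}\left(1+e^{\lambda+\lambda'}R_{n,k}\right),$$ $$\binom Nk e^{-\lambda'}\left(1-e^{\lambda'}F_{n,k}\right)\le f_B(k)\le \binom Nk e^{-\lambda'}\left(1+e^{\lambda'}F_{n,k}\right).$$ -/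

import Mathlib

open Finset

/-! Ferrers boards are Young diagrams: the square in row `i` and column `j` (both counted from `0`)
is `(i, j)`.  The row lengths are `B.rowLen 0 ≥ B.rowLen 1 ≥ …` (the partition `b`, with
`b_{i+1} = B.rowLen i`), the column lengths are `B.colLen 0 ≥ B.colLen 1 ≥ …` (the conjugate
partition `b'`).  There are `B.colLen 0` non-empty rows and `B.rowLen 0` non-empty columns. -/

namespace FerrersBoard

/-- The rook number `r_B(k)`: the number of sets of `k` squares of `B`, no two of which lie in the
same row or in the same column. -/
def rookNumber (B : YoungDiagram) (k : ℕ) : ℕ :=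
  #{P ∈ B.cells.powersetCard k | ∀ x ∈ P, ∀ y ∈ P, x ≠ y → x.1 ≠ y.1 ∧ x.2 ≠ y.2}

/-- The file number `f_B(k)`: the number of sets of `k` squares of `B`, no two of which lie in the
same column. -/
def fileNumber (B : YoungDiagram) (k : ℕ) : ℕ :=
  #{P ∈ B.cells.powersetCard k | ∀ x ∈ P, ∀ y ∈ P, x ≠ y → x.2 ≠ y.2}

/-- `N = ∑ b_i`. -/
def size (B : YoungDiagram) : ℕ := ∑ i ∈ range (B.colLen 0), B.rowLen i

/-- `L = ∑ C(b_i, 2)`. -/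
def rowPairs (B : YoungDiagram) : ℕ := ∑ i ∈ range (B.colLen 0), (B.rowLen i).choose 2

/-- `L' = ∑ C(b'_i, 2)`. -/
def colPairs (B : YoungDiagram) : ℕ := ∑ j ∈ range (B.rowLen 0), (B.colLen j).choose 2

noncomputable section

/-- `λ = C(k, 2) L / C(N, 2)`. -/
def rowRate (B : YoungDiagram) (k : ℕ) : ℝ :=
  (k.choose 2 : ℝ) * (rowPairs B : ℝ) / ((size B).choose 2 : ℝ)

/-- `λ' = C(k, 2) L' / C(N, 2)`. -/
def colRate (B : YoungDiagram) (k : ℕ) : ℝ :=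
  (k.choose 2 : ℝ) * (colPairs B : ℝ) / ((size B).choose 2 : ℝ)

/-- `s_0 = L / C(N, 2)`. -/
def s0 (B : YoungDiagram) : ℝ := (rowPairs B : ℝ) / ((size B).choose 2 : ℝ)

/-- `s_0' = L' / C(N, 2)`. -/
def s0' (B : YoungDiagram) : ℝ := (colPairs B : ℝ) / ((size B).choose 2 : ℝ)

/-- `s_1 = 2 (k - 2) L / C(N, 2)`. -/
def s1 (B : YoungDiagram) (k : ℕ) : ℝ :=
  2 * ((k : ℝ) - 2) * (rowPairs B : ℝ) / ((size B).choose 2 : ℝ)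

/-- `s_1' = 2 (k - 2) L' / C(N, 2)`. -/
def s1' (B : YoungDiagram) (k : ℕ) : ℝ :=
  2 * ((k : ℝ) - 2) * (colPairs B : ℝ) / ((size B).choose 2 : ℝ)

/-- `s_2 = (k - 2) ∑_i C(b_i, 2) (b_i - 2) / (N - 2)`. -/
def s2 (B : YoungDiagram) (k : ℕ) : ℝ :=
  ((k : ℝ) - 2) * ∑ i ∈ range (B.colLen 0),
    ((B.rowLen i).choose 2 : ℝ) * (((B.rowLen i : ℝ) - 2) / ((size B : ℝ) - 2))

/-- `s_2' = (k - 2) ∑_i C(b'_i, 2) (b'_i - 2) / (N - 2)`. -/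
def s2' (B : YoungDiagram) (k : ℕ) : ℝ :=
  ((k : ℝ) - 2) * ∑ j ∈ range (B.rowLen 0),
    ((B.colLen j).choose 2 : ℝ) * (((B.colLen j : ℝ) - 2) / ((size B : ℝ) - 2))

/-- `s_3 = (k - 2) ∑_i ∑_{1 ≤ c₁ < c₂ ≤ b_i} [(b'_{c₁} - 1) / (N - 2) + (b'_{c₂} - 1) / (N - 2)]`
(with `c₁, c₂` counted from `0` here). -/
def s3 (B : YoungDiagram) (k : ℕ) : ℝ :=
  ((k : ℝ) - 2) * ∑ i ∈ range (B.colLen 0),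
    ∑ c₁ ∈ range (B.rowLen i), ∑ c₂ ∈ Ioo c₁ (B.rowLen i),
      (((B.colLen c₁ : ℝ) - 1) / ((size B : ℝ) - 2) + ((B.colLen c₂ : ℝ) - 1) / ((size B : ℝ) - 2))

/-- `s_3' = (k - 2) ∑_i ∑_{1 ≤ c₁ < c₂ ≤ b'_i} [(b_{c₁} - 1) / (N - 2) + (b_{c₂} - 1) / (N - 2)]`
(with `c₁, c₂` counted from `0` here). -/
def s3' (B : YoungDiagram) (k : ℕ) : ℝ :=
  ((k : ℝ) - 2) * ∑ j ∈ range (B.rowLen 0),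
    ∑ c₁ ∈ range (B.colLen j), ∑ c₂ ∈ Ioo c₁ (B.colLen j),
      (((B.rowLen c₁ : ℝ) - 1) / ((size B : ℝ) - 2) + ((B.rowLen c₂ : ℝ) - 1) / ((size B : ℝ) - 2))

/-- `s_4 = (13 - 12 k + 3 k²) / C(N, 2)`. -/
def s4 (B : YoungDiagram) (k : ℕ) : ℝ :=
  (13 - 12 * (k : ℝ) + 3 * (k : ℝ) ^ 2) / ((size B).choose 2 : ℝ)

/-- `d_3 = s_0 + s_0' + s_1 + s_1' + (s_2 + s_2' + s_3 + s_3') / (L + L') + s_4`. -/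
def d3 (B : YoungDiagram) (k : ℕ) : ℝ :=
  s0 B + s0' B + s1 B k + s1' B k
    + (s2 B k + s2' B k + s3 B k + s3' B k) / ((rowPairs B : ℝ) + (colPairs B : ℝ)) + s4 B k

/-- `d_4 = s_0' + s_1' + (s_2' + s_3') / L' + s_4`.  If `L' = 0` (at most one row), then `λ' = 0`
and `s_2' = s_3' = 0`, and the quotient is read as `0`. -/
def d4 (B : YoungDiagram) (k : ℕ) : ℝ :=
  s0' B + s1' B k + (s2' B k + s3' B k) / (colPairs B : ℝ) + s4 B k

/-- The error term `min (d_3, (λ + λ') d_3, 1)` for rook numbers. -/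
def rookError (B : YoungDiagram) (k : ℕ) : ℝ :=
  min (d3 B k) (min ((rowRate B k + colRate B k) * d3 B k) 1)

/-- The error term `min (d_4, λ' d_4, 1)` for file numbers. -/
def fileError (B : YoungDiagram) (k : ℕ) : ℝ :=
  min (d4 B k) (min (colRate B k * d4 B k) 1)

end

end FerrersBoard

/-! Both counts concern `k`-subsets `P` of the `N` squares that contain no pair from a graph `E`:
the attacking pairs for rooks, the same-column pairs for files. Let `P` be uniformly random, `X` the
number of pairs of `E` inside it, `λ` the mean of `X`, and `φ(t) = 𝔼 t^X` (`genFun`). Then `φ(1) =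
1`, `φ(0)` is the probability sought, and `φ' ≈ λ φ`, so `φ(0) ≈ e^{-λ}`.

Given `a ⊆ P` with `a ∈ E`, write `P = R ∪ a`; then `X(P) = X(R) + 1 + Y`, where `Y` counts the
pairs meeting `a` that `R` completes. Averages of monotone set functions move in a known direction
between `R` and `P` (`average_le`). Bernoulli's inequality for `t^Y` on one side and `t^Y ≤ 1` on
the other yield two differential inequalities (`le_deriv_genFun`, `deriv_genFun_le`), and
integrating them against `e^{-λt}` bounds `φ(0) - e^{-λ}` from both sides.

Let `u` be the mean of `Y` (`excess`). The target error is `d ≥ u/2 + s`. The lower bound meets it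
directly. The upper bound costs up to `u` when `λ` is large, twice what is allowed. The missing
factor comes from `𝔼 (Y t^X)`: since `t^X ≤ t + (1 - t) 1[X = 0]`, it suffices that `X = 0` is
unlikely, and the second moment method gives roughly `3 / (3 + λ)` as soon as `u ≤ 2`
(`free_mul_le`, `free_sdiff_le`, `upper_error_le`). All this gives `abs_free_sub_exp_le` for any
graph.

For a board, vertex degrees express `u/2` through `s2`, `s2'`, `s3`. It remains to see that `s`
absorbs `2(k-3)/(N-2)`, the price of avoiding three squares. The rook graph has at least `N - 1`
edges, which suffices; the same-column graph may be sparse, and there `s3'` makes up the difference.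
-/

namespace PairCount

/-! ### Averages over subsets of fixed size, and counts of pairs inside them. -/

variable {α : Type*} [DecidableEq α]

/-- The number of members of `E` contained in `P`. -/
def inside (E : Finset (Finset α)) (P : Finset α) : ℕ := #{e ∈ E | e ⊆ P}

/-- The members of `E` other than `a` that meet `a`. -/
def meeting (E : Finset (Finset α)) (a : Finset α) : Finset (Finset α) :=
  {e ∈ E | e ≠ a ∧ ¬ Disjoint e a}

theorem inside_mono (E : Finset (Finset α)) : Monotone (inside E) := fun _ _ h =>
  card_le_card fun e he => by
    rw [mem_filter] at he ⊢
    exact ⟨he.1, he.2.trans h⟩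

theorem sum_powersetCard_superset {U b : Finset α} (hb : b ⊆ U) (k : ℕ) (f : Finset α → ℝ) :
    ∑ P ∈ U.powersetCard (k + #b) with b ⊆ P, f P
      = ∑ R ∈ (U \ b).powersetCard k, f (R ∪ b) := by
  refine sum_bij' (fun P _ => P \ b) (fun R _ => R ∪ b) ?_ ?_ ?_ ?_ ?_
  · intro P hP
    simp only [mem_filter, mem_powersetCard] at hP ⊢
    refine ⟨sdiff_subset_sdiff hP.1.1 le_rfl, ?_⟩
    rw [card_sdiff_of_subset hP.2, hP.1.2]; omega
  · intro R hR
    simp only [mem_filter, mem_powersetCard] at hR ⊢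
    have hd : Disjoint R b := disjoint_of_subset_left hR.1 sdiff_disjoint
    refine ⟨⟨union_subset (hR.1.trans sdiff_subset) hb, ?_⟩, subset_union_right⟩
    rw [card_union_of_disjoint hd, hR.2]
  · intro P hP
    simp only [mem_filter] at hP
    exact sdiff_union_of_subset hP.2
  · intro R hR
    simp only [mem_powersetCard] at hR
    exact union_sdiff_cancel_right (disjoint_of_subset_left hR.1 sdiff_disjoint)
  · intro P hP
    simp only [mem_filter] at hP
    rw [sdiff_union_of_subset hP.2]

theorem sum_powersetCard_mem {U : Finset α} {x : α} (hx : x ∈ U) (k : ℕ) (f : Finset α → ℝ) :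
    ∑ P ∈ U.powersetCard (k + 1) with x ∈ P, f P
      = ∑ R ∈ (U.erase x).powersetCard k, f (insert x R) := by
  have := sum_powersetCard_superset (b := {x}) (singleton_subset_iff.2 hx) k f
  simpa [sdiff_singleton_eq_erase, union_comm, ← insert_eq] using this

theorem sum_powersetCard_not_mem {U : Finset α} {x : α} (k : ℕ) (f : Finset α → ℝ) :
    ∑ P ∈ U.powersetCard k with x ∉ P, f P = ∑ R ∈ (U.erase x).powersetCard k, f R := by
  congr 1
  ext P
  simp only [mem_filter, mem_powersetCard, subset_erase]
  tauto

/-- Double counting: each `k`-set `R` arises once for each of the `#U - k` elements outside it. -/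
theorem sum_sum_erase (U : Finset α) (k : ℕ) (f : Finset α → ℝ) :
    ∑ P ∈ U.powersetCard (k + 1), ∑ q ∈ P, f (P.erase q)
      = ((#U : ℝ) - k) * ∑ R ∈ U.powersetCard k, f R := by
  have h1 : ∑ P ∈ U.powersetCard (k + 1), ∑ q ∈ P, f (P.erase q)
      = ∑ q ∈ U, ∑ R ∈ (U.erase q).powersetCard k, f R := by
    rw [sum_comm' (t' := U) (s' := fun q => {P ∈ U.powersetCard (k + 1) | q ∈ P})]
    · refine sum_congr rfl fun q hq => ?_
      rw [sum_powersetCard_mem hq k fun P => f (P.erase q)]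
      refine sum_congr rfl fun R hR => ?_
      rw [erase_insert]
      exact fun h => notMem_erase q U ((mem_powersetCard.1 hR).1 h)
    · intro P q
      simp only [mem_filter, mem_powersetCard]
      exact ⟨fun h => ⟨⟨h.1, h.2⟩, h.1.1 h.2⟩, fun h => ⟨h.1.1, h.1.2⟩⟩
  have h2 : ∑ q ∈ U, ∑ R ∈ (U.erase q).powersetCard k, f R
      = ∑ R ∈ U.powersetCard k, ∑ q ∈ U \ R, f R := by
    refine sum_comm' fun q R => ?_
    simp only [mem_powersetCard, subset_erase, mem_sdiff]
    tauto
  rw [h1, h2, mul_sum]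
  refine sum_congr rfl fun R hR => ?_
  rw [mem_powersetCard] at hR
  rw [sum_const, nsmul_eq_mul, card_sdiff_of_subset hR.1, hR.2,
    Nat.cast_sub (hR.2 ▸ card_le_card hR.1)]

/-- Averages of a monotone set function grow when a forced element is released. -/
theorem card_mul_sum_erase_le {U : Finset α} {x : α} (hx : x ∈ U) (k : ℕ) {h : Finset α → ℝ}
    (hh : Monotone h) :
    (#U : ℝ) * ∑ R ∈ (U.erase x).powersetCard k, h R
      ≤ (k + 1) * ∑ P ∈ U.powersetCard (k + 1), h P := by
  have hc : (#(U.erase x) : ℝ) = #U - 1 := by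
    rw [card_erase_of_mem hx, Nat.cast_sub (card_pos.2 ⟨x, hx⟩), Nat.cast_one]
  have h1 := sum_sum_erase (U.erase x) k h
  have h2 : ∑ P ∈ (U.erase x).powersetCard (k + 1), ∑ q ∈ P, h (P.erase q)
      ≤ (k + 1) * ∑ P ∈ (U.erase x).powersetCard (k + 1), h P := by
    rw [mul_sum]
    refine sum_le_sum fun P hP => ?_
    calc ∑ q ∈ P, h (P.erase q) ≤ ∑ q ∈ P, h P := sum_le_sum fun q _ => hh (erase_subset q P)
      _ = _ := by rw [sum_const, nsmul_eq_mul, (mem_powersetCard.1 hP).2]; push_cast; ring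
  have h3 : ∑ R ∈ (U.erase x).powersetCard k, h R
      ≤ ∑ R ∈ (U.erase x).powersetCard k, h (insert x R) :=
    sum_le_sum fun R _ => hh (subset_insert x R)
  rw [← sum_powersetCard_mem hx] at h3
  have h4 := sum_filter_add_sum_filter_not (U.powersetCard (k + 1)) (fun P => x ∈ P) h
  rw [sum_powersetCard_not_mem] at h4
  rw [hc] at h1
  rw [← h4, mul_add]
  -- With `A` the sum on the left, `h1` and `h2` bound `(#U - 1 - k) A` by `k + 1` times the sum
  -- over sets avoiding `x`, and `h3` bounds `(k + 1) A` by `k + 1` times the sum over sets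
  -- containing `x`.
  nlinarith [mul_le_mul_of_nonneg_left h3 (by positivity : (0 : ℝ) ≤ k + 1)]

theorem card_mul_sum_sdiff_le {U b : Finset α} (hb : b ∈ U.powersetCard 2) (k : ℕ)
    {h : Finset α → ℝ} (hh : Monotone h) :
    (#U : ℝ) * (#U - 1) * ∑ R ∈ (U \ b).powersetCard k, h R
      ≤ (k + 2) * (k + 1) * ∑ P ∈ U.powersetCard (k + 2), h P := by
  obtain ⟨hbU, hb2⟩ := mem_powersetCard.1 hb
  obtain ⟨x, y, hxy, rfl⟩ := card_eq_two.1 hb2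
  have hx : x ∈ U := hbU (by simp)
  have hy : y ∈ U.erase x := mem_erase.2 ⟨hxy.symm, hbU (by simp)⟩
  have e : U \ {x, y} = (U.erase x).erase y := by
    ext z; simp only [mem_sdiff, mem_insert, mem_singleton, mem_erase]; tauto
  have h1 := card_mul_sum_erase_le hx (k + 1) hh
  have h2 := card_mul_sum_erase_le hy k hh
  rw [card_erase_of_mem hx, Nat.cast_sub (card_pos.2 ⟨x, hx⟩), Nat.cast_one] at h2
  rw [e]
  push_cast at h1
  have hk : (0 : ℝ) ≤ k + 1 := by positivity
  have h3 := mul_le_mul_of_nonneg_left h1 hk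
  have h4 := mul_le_mul_of_nonneg_left h2 (Nat.cast_nonneg (α := ℝ) #U)
  have e2 : (k : ℝ) + 1 + 1 = k + 2 := by ring
  rw [e2] at h3
  calc _ = (#U : ℝ) * ((#U - 1) * ∑ R ∈ ((U.erase x).erase y).powersetCard k, h R) := by ring
    _ ≤ _ := h4
    _ = (k + 1) * ((#U : ℝ) * ∑ P ∈ (U.erase x).powersetCard (k + 1), h P) := by ring
    _ ≤ _ := h3
    _ = _ := by ring

/-- Write `inside E P` as a sum of indicators of `a ⊆ P` and split off `a` from `P`. This is how
conditioning on a pair enters. -/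
theorem sum_inside_mul {V : Finset α} {E : Finset (Finset α)} (hE : E ⊆ V.powersetCard 2) (j : ℕ)
    (f : Finset α → ℝ) :
    ∑ P ∈ V.powersetCard (j + 2), (inside E P : ℝ) * f P
      = ∑ a ∈ E, ∑ R ∈ (V \ a).powersetCard j, f (R ∪ a) := by
  have h1 : ∀ P, (inside E P : ℝ) * f P = ∑ a ∈ E, if a ⊆ P then f P else 0 := fun P => by
    rw [← sum_filter, sum_const, nsmul_eq_mul]; rfl
  simp_rw [h1]
  rw [sum_comm]
  refine sum_congr rfl fun a ha => ?_
  obtain ⟨h2, h3⟩ := mem_powersetCard.1 (hE ha)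
  rw [← sum_filter, ← sum_powersetCard_superset h2, h3]

/-- A pair inside `R ∪ a` is disjoint from `a`, hence inside `R`, or is `a` itself, or meets `a` in
one point. -/
theorem inside_union {V : Finset α} {E : Finset (Finset α)} (hE : E ⊆ V.powersetCard 2)
    {a R : Finset α} (ha : a ∈ E) (hR : Disjoint R a) :
    inside E (R ∪ a) = inside E R + 1 + #{e ∈ meeting E a | e ⊆ R ∪ a} := by
  have hne : ∀ e ∈ E, e.Nonempty := fun e he => by
    rw [← card_pos, (mem_powersetCard.1 (hE he)).2]; norm_num
  have h1 : E.filter (fun e => e ⊆ R ∪ a)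
      = (E.filter (fun e => e ⊆ R) ∪ {a}) ∪ (meeting E a).filter (fun e => e ⊆ R ∪ a) := by
    ext e
    simp only [meeting, mem_filter, mem_union, mem_singleton]
    constructor
    · rintro ⟨he, hs⟩
      by_cases h : e = a
      · exact Or.inl (Or.inr h)
      by_cases hd : Disjoint e a
      · refine Or.inl (Or.inl ⟨he, fun z hz => ?_⟩)
        rcases mem_union.1 (hs hz) with h' | h'
        · exact h'
        · exact absurd h' (disjoint_left.1 hd hz)
      · exact Or.inr ⟨⟨he, h, hd⟩, hs⟩
    · rintro ((⟨he, hs⟩ | rfl) | ⟨⟨he, -, -⟩, hs⟩)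
      · exact ⟨he, hs.trans subset_union_left⟩
      · exact ⟨ha, subset_union_right⟩
      · exact ⟨he, hs⟩
  unfold inside
  rw [h1, card_union_of_disjoint, card_union_of_disjoint, card_singleton]
  · rw [disjoint_singleton_right, mem_filter]
    rintro ⟨h, h'⟩
    exact (hne a ha).ne_empty (disjoint_self_iff_empty a |>.1 (disjoint_of_subset_left h' hR))
  · rw [disjoint_left]
    intro e he he'
    simp only [meeting, mem_filter] at he'
    rcases mem_union.1 he with h | h
    · exact he'.1.2.2 (disjoint_of_subset_left (mem_filter.1 h).2 hR)
    · exact he'.1.2.1 (mem_singleton.1 h)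

theorem card_inter_eq_one {V : Finset α} {E : Finset (Finset α)} (hE : E ⊆ V.powersetCard 2)
    {a e : Finset α} (ha : a ∈ E) (he : e ∈ meeting E a) : #(e ∩ a) = 1 := by
  obtain ⟨he, hne, hd⟩ := mem_filter.1 he
  have h1 := (mem_powersetCard.1 (hE ha)).2
  have h2 := (mem_powersetCard.1 (hE he)).2
  have h3 : 0 < #(e ∩ a) := card_pos.2 (not_disjoint_iff_nonempty_inter.1 hd)
  have h4 : #(e ∩ a) ≤ 2 := h2 ▸ card_le_card inter_subset_left
  by_contra h
  have h5 : #(e ∩ a) = 2 := by omega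
  exact hne ((eq_of_subset_of_card_le inter_subset_left (by omega : #e ≤ #(e ∩ a))).symm.trans
    (eq_of_subset_of_card_le inter_subset_right (by omega : #a ≤ #(e ∩ a))))

/-- A pair `e` meeting `a` has one point outside `a`, so `e ⊆ R ∪ a` fixes one point of `R`.
Deleting it leaves a set `Q` that avoids the three points of `a ∪ e`, and `f R ≤ f Q`. -/
theorem sum_meeting_mul_le {V : Finset α} {E : Finset (Finset α)} (hE : E ⊆ V.powersetCard 2)
    {a : Finset α} (ha : a ∈ E) (j : ℕ) {f : Finset α → ℝ} (hf : Antitone f) {b : ℝ} (hb : 0 ≤ b)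
    (hfb : 1 ≤ j → ∀ T ⊆ V, #T = 3 → ∑ Q ∈ (V \ T).powersetCard (j - 1), f Q ≤ b) :
    ∑ R ∈ (V \ a).powersetCard j, (#{e ∈ meeting E a | e ⊆ R ∪ a} : ℝ) * f R
      ≤ #(meeting E a) * b := by
  have h1 : ∀ R, (#{e ∈ meeting E a | e ⊆ R ∪ a} : ℝ) * f R
      = ∑ e ∈ meeting E a, if e ⊆ R ∪ a then f R else 0 := fun P => by
    rw [← sum_filter, sum_const, nsmul_eq_mul]
  simp_rw [h1]
  rw [sum_comm, ← nsmul_eq_mul, ← sum_const]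
  refine sum_le_sum fun e he => ?_
  have hi := card_inter_eq_one hE ha he
  obtain ⟨haV, ha2⟩ := mem_powersetCard.1 (hE ha)
  obtain ⟨heV, he2⟩ := mem_powersetCard.1 (hE (mem_filter.1 he).1)
  have hd : #(e \ a) = 1 := by
    have := card_sdiff_add_card_inter e a; omega
  have h2 : ∀ R, e ⊆ R ∪ a ↔ e \ a ⊆ R := fun R => by
    rw [union_comm]; exact (sdiff_le_iff (a := e) (b := a) (c := R)).symm
  simp_rw [h2]
  rw [← sum_filter]
  rcases j with _ | j
  -- For `j = 0` the empty `R` completes no pair.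
  · rw [powersetCard_zero, filter_singleton, if_neg]
    · simpa using hb
    · rw [subset_empty]; intro h; rw [h] at hd; simp at hd
  · have h3 := sum_powersetCard_superset (U := V \ a) (b := e \ a) (sdiff_subset_sdiff heV le_rfl) j f
    rw [hd] at h3
    rw [h3]
    have h4 : (V \ a) \ (e \ a) = V \ (a ∪ e) := by
      ext z; simp only [mem_sdiff, mem_union]; tauto
    rw [h4]
    refine (sum_le_sum fun Q _ => hf subset_union_left).trans
      (hfb (by omega) (a ∪ e) (union_subset haV heV) ?_)
    rw [← union_sdiff_self_eq_union, card_union_of_disjoint disjoint_sdiff, ha2, hd]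

theorem sum_inside {V : Finset α} {E : Finset (Finset α)} (hE : E ⊆ V.powersetCard 2) (j : ℕ) :
    ∑ P ∈ V.powersetCard (j + 2), (inside E P : ℝ) = #E * (#V - 2).choose j := by
  have := sum_inside_mul hE j fun _ => 1
  simp only [mul_one] at this
  rw [this, ← nsmul_eq_mul, ← sum_const]
  refine sum_congr rfl fun a ha => ?_
  obtain ⟨h1, h2⟩ := mem_powersetCard.1 (hE ha)
  simp [card_sdiff_of_subset h1, h2]

theorem card_disjoint_filter {V : Finset α} {E : Finset (Finset α)} (hE : E ⊆ V.powersetCard 2)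
    {a : Finset α} (ha : a ∈ E) : #{e ∈ E | Disjoint e a} + 1 + #(meeting E a) = #E := by
  have h1 : #{e ∈ E | ¬ Disjoint e a} = 1 + #(meeting E a) := by
    have : {e ∈ E | ¬ Disjoint e a} = {a} ∪ meeting E a := by
      ext e
      simp only [meeting, mem_filter, mem_union, mem_singleton]
      constructor
      · rintro ⟨h, h'⟩
        by_cases h'' : e = a
        · exact Or.inl h''
        · exact Or.inr ⟨h, h'', h'⟩
      · rintro (rfl | h)
        · refine ⟨ha, fun h => ?_⟩
          have := (mem_powersetCard.1 (hE ha)).2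
          rw [disjoint_self_iff_empty] at h
          simp [h] at this
        · exact ⟨h.1, h.2.2⟩
    rw [this, card_union_of_disjoint (disjoint_singleton_left.2 (by simp [meeting])),
      card_singleton]
  have h2 := card_filter_add_card_filter_not (s := E) (fun e => Disjoint e a)
  omega

/-- Only the pairs disjoint from `a` can lie in `R`. This exact mean is what `deriv_genFun_le`
compares with `rate`. -/
theorem sum_inside_sdiff {V : Finset α} {E : Finset (Finset α)} (hE : E ⊆ V.powersetCard 2)
    {a : Finset α} (ha : a ∈ E) (j : ℕ) :
    ∑ R ∈ (V \ a).powersetCard (j + 2), (inside E R : ℝ)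
      = (#E - 1 - #(meeting E a)) * (#V - 4).choose j := by
  obtain ⟨h1, h2⟩ := mem_powersetCard.1 (hE ha)
  have hE' : {e ∈ E | Disjoint e a} ⊆ (V \ a).powersetCard 2 := fun e he => by
    obtain ⟨he, hd⟩ := mem_filter.1 he
    obtain ⟨h3, h4⟩ := mem_powersetCard.1 (hE he)
    exact mem_powersetCard.2 ⟨subset_sdiff.2 ⟨h3, hd⟩, h4⟩
  have h5 := sum_inside hE' j
  rw [card_sdiff_of_subset h1, h2, Nat.sub_sub] at h5
  have h6 : (#E : ℝ) - 1 - #(meeting E a) = #{e ∈ E | Disjoint e a} := by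
    rw [← card_disjoint_filter hE ha]; push_cast; ring
  rw [h6, ← h5]
  refine sum_congr rfl fun R hR => ?_
  unfold inside
  rw [filter_filter]
  congr 2
  ext e
  simp only [mem_filter, and_congr_right_iff]
  exact fun _ => ⟨fun h => ⟨disjoint_of_subset_left (h.trans (mem_powersetCard.1 hR).1)
    sdiff_disjoint, h⟩, fun h => h.2⟩

end PairCount

/-! ### The generating function: moments and bounds on the derivative. -/

namespace PairCount

variable {α : Type*} [DecidableEq α]

/-- The number of `k`-subsets of `V` containing no member of `E`. -/
def free (E : Finset (Finset α)) (V : Finset α) (k : ℕ) : ℕ :=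
  #{P ∈ V.powersetCard k | inside E P = 0}

/-- The number of ordered pairs of distinct members of `E` that meet. -/
def overlaps (E : Finset (Finset α)) : ℕ := ∑ a ∈ E, #(meeting E a)

noncomputable section

/-- The mean number of members of `E` inside a random `(j + 2)`-subset of an `n`-set. -/
def rate (E : Finset (Finset α)) (n j : ℕ) : ℝ := #E * ((j + 2) * (j + 1)) / (n * (n - 1))

/-- The mean number of members of `E` that meet a random member `a` of `E` and are completed by
a random `j`-set disjoint from `a`. -/
def excess (E : Finset (Finset α)) (n j : ℕ) : ℝ := overlaps E * j / ((n - 2) * #E)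

/-- The probability generating function of the number of members of `E` inside a random
`k`-subset of `V`. -/
def genFun (E : Finset (Finset α)) (V : Finset α) (k : ℕ) (t : ℝ) : ℝ :=
  (∑ P ∈ V.powersetCard k, t ^ inside E P) / (#V).choose k

end

theorem choose_two_step {n j : ℕ} (h : j + 2 ≤ n) :
    (n : ℝ) * (n - 1) * (n - 2).choose j = (j + 2) * (j + 1) * n.choose (j + 2) := by
  obtain ⟨m, rfl⟩ : ∃ m, n = m + 2 := ⟨n - 2, by omega⟩
  have h1 := Nat.add_one_mul_choose_eq (m + 1) (j + 1)
  have h2 := Nat.add_one_mul_choose_eq m j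
  have h1' : ((m : ℝ) + 1 + 1) * (m + 1).choose (j + 1) = (m + 1 + 1).choose (j + 1 + 1) * (j + 1 + 1) := by
    exact_mod_cast h1
  have h2' : ((m : ℝ) + 1) * m.choose j = (m + 1).choose (j + 1) * (j + 1) := by exact_mod_cast h2
  simp only [Nat.add_sub_cancel]
  push_cast
  rw [show m + 2 = m + 1 + 1 from rfl, show j + 2 = j + 1 + 1 from rfl]
  linear_combination ((m : ℝ) + 2) * h2' + (j + 1) * h1'

theorem choose_pos_real {n k : ℕ} (h : k ≤ n) : (0 : ℝ) < n.choose k := by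
  exact_mod_cast Nat.choose_pos h

theorem choose_one_step {n j : ℕ} (h : j + 2 ≤ n) (hj : 1 ≤ j) :
    ((n - 3).choose (j - 1) : ℝ) = (n - 2).choose j * j / (n - 2) := by
  obtain ⟨m, rfl⟩ : ∃ m, n = m + 3 := ⟨n - 3, by omega⟩
  obtain ⟨i, rfl⟩ : ∃ i, j = i + 1 := ⟨j - 1, by omega⟩
  have h1 : ((m : ℝ) + 1) * m.choose i = (m + 1).choose (i + 1) * (i + 1) := by
    exact_mod_cast Nat.add_one_mul_choose_eq m i
  rw [show m + 3 - 2 = m + 1 from rfl]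
  simp only [Nat.add_sub_cancel]
  push_cast
  rw [eq_div_iff (by have : (0 : ℝ) ≤ m := m.cast_nonneg
                     intro h; linarith)]
  linear_combination h1

section

variable {V : Finset α} {E : Finset (Finset α)} {j : ℕ}

theorem rate_eq {β : Type*} {V : Finset β} {E : Finset (Finset β)} {j : ℕ} (hj : j + 2 ≤ #V) :
    rate E #V j = #E * ((#V - 2).choose j / (#V).choose (j + 2)) := by
  have h := choose_two_step hj
  have h1 := choose_pos_real hj
  have h2 : (2 : ℝ) ≤ #V := by exact_mod_cast (by omega : 2 ≤ #V)
  unfold rate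
  rw [mul_div_assoc]
  congr 1
  rw [div_eq_div_iff (by nlinarith) h1.ne']
  linear_combination -h

/-- Normalised form of `card_mul_sum_sdiff_le`: the average over `j`-sets avoiding `a` is at most
the average over all `(j + 2)`-sets. -/
theorem average_le (hE : E ⊆ V.powersetCard 2) (hj : j + 2 ≤ #V) {a : Finset α} (ha : a ∈ E)
    {h : Finset α → ℝ} (hh : Monotone h) :
    ∑ R ∈ (V \ a).powersetCard j, h R
      ≤ (#V - 2).choose j / (#V).choose (j + 2) * ∑ P ∈ V.powersetCard (j + 2), h P := by
  have h1 := card_mul_sum_sdiff_le (hE ha) j hh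
  have h2 := choose_two_step hj
  have h3 := choose_pos_real hj
  have h4 : (2 : ℝ) ≤ #V := by exact_mod_cast (by omega : 2 ≤ #V)
  have h5 : (0 : ℝ) < #V * (#V - 1) := by nlinarith
  have h6 : ((#V - 2).choose j / (#V).choose (j + 2) : ℝ) = (j + 2) * (j + 1) / (#V * (#V - 1)) := by
    rw [div_eq_div_iff h3.ne' h5.ne']
    linear_combination h2
  rw [h6, div_mul_eq_mul_div, le_div_iff₀ h5]
  linarith

theorem sum_inside_eq_rate (hE : E ⊆ V.powersetCard 2) (hj : j + 2 ≤ #V) :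
    ∑ P ∈ V.powersetCard (j + 2), (inside E P : ℝ) = rate E #V j * (#V).choose (j + 2) := by
  rw [sum_inside hE, rate_eq hj]
  field_simp [(choose_pos_real hj).ne']

theorem rate_nonneg {β : Type*} {V : Finset β} {E : Finset (Finset β)} {j : ℕ} (hj : j + 2 ≤ #V) : 0 ≤ rate E #V j := by
  rw [rate_eq hj]; positivity

theorem sum_overlaps (c : ℝ) : ∑ a ∈ E, (#(meeting E a) : ℝ) * c = overlaps E * c := by
  rw [← sum_mul, overlaps]; push_cast; rfl

theorem rate_mul_excess (hj : j + 2 ≤ #V) (hM : 0 < #E) :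
    rate E #V j * excess E #V j
      = overlaps E * ((#V - 2).choose j / (#V).choose (j + 2) * (j / (#V - 2))) := by
  rw [rate_eq hj]
  have h1 : (#E : ℝ) ≠ 0 := by exact_mod_cast hM.ne'
  unfold excess
  rw [mul_comm ((#V : ℝ) - 2), ← div_div]
  field_simp

/-- Condition one factor of `X²` on a pair `a`; the other has mean at most `rate` from `R`, plus `1`
from `a`, plus the mean number of completed pairs meeting `a`. -/
theorem sum_sq_inside_le (hE : E ⊆ V.powersetCard 2) (hj : j + 2 ≤ #V) (hM : 0 < #E) :
    ∑ P ∈ V.powersetCard (j + 2), (inside E P : ℝ) ^ 2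
      ≤ (#V).choose (j + 2) * (rate E #V j * (rate E #V j + 1 + excess E #V j)) := by
  have hC := choose_pos_real hj
  have h2 : (2 : ℝ) ≤ #V := by exact_mod_cast (by omega : 2 ≤ #V)
  have hb : (0 : ℝ) ≤ (#V - 2).choose j * j / (#V - 2) :=
    div_nonneg (by positivity) (by linarith)
  have h1 : ∀ a ∈ E, ∑ R ∈ (V \ a).powersetCard j, (inside E (R ∪ a) : ℝ)
      ≤ (#V - 2).choose j / (#V).choose (j + 2) * (rate E #V j * (#V).choose (j + 2))
        + (#V - 2).choose j + #(meeting E a) * ((#V - 2).choose j * j / (#V - 2)) := by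
    intro a ha
    obtain ⟨haV, ha2⟩ := mem_powersetCard.1 (hE ha)
    have e1 : ∑ R ∈ (V \ a).powersetCard j, (inside E (R ∪ a) : ℝ)
        = ∑ R ∈ (V \ a).powersetCard j, (inside E R : ℝ) + ((#V - 2).choose j : ℝ)
          + ∑ R ∈ (V \ a).powersetCard j, (#{e ∈ meeting E a | e ⊆ R ∪ a} : ℝ) * 1 := by
      have : ((#V - 2).choose j : ℝ) = ∑ R ∈ (V \ a).powersetCard j, 1 := by
        simp [card_sdiff_of_subset haV, ha2]
      rw [this, ← sum_add_distrib, ← sum_add_distrib]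
      refine sum_congr rfl fun R hR => ?_
      rw [inside_union hE ha (disjoint_of_subset_left (mem_powersetCard.1 hR).1 sdiff_disjoint)]
      push_cast; ring
    rw [e1]
    have e2 := average_le hE hj ha (h := fun P => (inside E P : ℝ))
      fun A B hAB => Nat.cast_le.2 (inside_mono E hAB)
    rw [sum_inside_eq_rate hE hj] at e2
    have e3 := sum_meeting_mul_le hE ha j (f := fun _ => 1) (fun _ _ _ => le_rfl) hb
      fun hj1 T hT hT3 => by
        rw [← choose_one_step hj hj1]
        simp [card_sdiff_of_subset hT, hT3]
    linarith
  calc ∑ P ∈ V.powersetCard (j + 2), (inside E P : ℝ) ^ 2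
      = ∑ a ∈ E, ∑ R ∈ (V \ a).powersetCard j, (inside E (R ∪ a) : ℝ) := by
        rw [← sum_inside_mul hE j fun P => (inside E P : ℝ)]
        exact sum_congr rfl fun P _ => sq _
    _ ≤ ∑ a ∈ E, ((#V - 2).choose j / (#V).choose (j + 2) * (rate E #V j * (#V).choose (j + 2))
        + (#V - 2).choose j + #(meeting E a) * ((#V - 2).choose j * j / (#V - 2))) :=
        sum_le_sum h1
    _ = _ := by
        rw [sum_add_distrib, sum_overlaps, sum_const, nsmul_eq_mul]
        have e4 := rate_mul_excess hj hM
        have e5 := rate_eq (E := E) hj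
        have e6 : (overlaps E : ℝ) * ((#V - 2).choose j * j / (#V - 2))
            = (#V).choose (j + 2) * (rate E #V j * excess E #V j) := by
          rw [e4]; field_simp
        have e7 : (#E : ℝ) * (#V - 2).choose j = (#V).choose (j + 2) * rate E #V j := by
          rw [e5]; field_simp
        have e8 : (#E : ℝ) * ((#V - 2).choose j / (#V).choose (j + 2)
            * (rate E #V j * (#V).choose (j + 2))) = (#V).choose (j + 2) * rate E #V j ^ 2 := by
          rw [← mul_assoc, ← e5]; ring
        rw [e6, mul_add, e7, e8]; ring

/-- The second moment bound for the probability that no member of `E` is contained in a random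
subset. -/
theorem rate_le_of_second_moment (hE : E ⊆ V.powersetCard 2) (hj : j + 2 ≤ #V) (hM : 0 < #E) :
    rate E #V j * (#V).choose (j + 2)
      ≤ ((#V).choose (j + 2) - free E V (j + 2)) * (rate E #V j + 1 + excess E #V j) := by
  have hC := choose_pos_real hj
  have h2 : (2 : ℝ) ≤ #V := by exact_mod_cast (by omega : 2 ≤ #V)
  have hr : 0 < rate E #V j := by
    have : (0 : ℝ) < #E := by exact_mod_cast hM
    unfold rate
    exact div_pos (by positivity) (by nlinarith)
  have h1 := sum_sq_inside_le hE hj hM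
  -- Cauchy–Schwarz on the event `X ≠ 0`, which carries all of the first moment.
  have h3 := sq_sum_le_card_mul_sum_sq (s := {P ∈ V.powersetCard (j + 2) | ¬ inside E P = 0})
    (f := fun P => (inside E P : ℝ))
  have h4 : ∑ P ∈ V.powersetCard (j + 2) with ¬ inside E P = 0, (inside E P : ℝ)
      = ∑ P ∈ V.powersetCard (j + 2), (inside E P : ℝ) :=
    sum_filter_of_ne fun P _ h => by exact_mod_cast h
  have h5 : ∑ P ∈ V.powersetCard (j + 2) with ¬ inside E P = 0, (inside E P : ℝ) ^ 2
      ≤ ∑ P ∈ V.powersetCard (j + 2), (inside E P : ℝ) ^ 2 :=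
    sum_le_sum_of_subset_of_nonneg (filter_subset _ _) fun _ _ _ => by positivity
  have h6 : (#{P ∈ V.powersetCard (j + 2) | ¬ inside E P = 0} : ℝ)
      = (#V).choose (j + 2) - free E V (j + 2) := by
    rw [eq_sub_iff_add_eq, free, add_comm]
    have := card_filter_add_card_filter_not (s := V.powersetCard (j + 2)) (fun P => inside E P = 0)
    rw [card_powersetCard] at this
    exact_mod_cast this
  rw [h4, h6, sum_inside_eq_rate hE hj] at h3
  have h7 : (0 : ℝ) ≤ (#V).choose (j + 2) - free E V (j + 2) := by rw [← h6]; positivity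
  have h8 := h3.trans (mul_le_mul_of_nonneg_left (h5.trans h1) h7)
  have h9 : 0 < rate E #V j * (#V).choose (j + 2) := by positivity
  refine le_of_mul_le_mul_left ?_ h9
  calc _ = (rate E #V j * (#V).choose (j + 2)) ^ 2 := by ring
    _ ≤ _ := h8
    _ = _ := by ring

theorem free_add_sum_inside_ge (hE : E ⊆ V.powersetCard 2) (hj : j + 2 ≤ #V) :
    (#V).choose (j + 2) * (1 - rate E #V j) ≤ free E V (j + 2) := by
  have h1 := sum_inside_eq_rate hE hj
  have h2 : ((#V).choose (j + 2) : ℝ) = ∑ P ∈ V.powersetCard (j + 2), 1 := by simp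
  have h3 : (free E V (j + 2) : ℝ)
      = ∑ P ∈ V.powersetCard (j + 2), if inside E P = 0 then (1 : ℝ) else 0 := by
    simp [free]
  have h4 : ∑ P ∈ V.powersetCard (j + 2), ((1 : ℝ) - inside E P)
      ≤ ∑ P ∈ V.powersetCard (j + 2), if inside E P = 0 then (1 : ℝ) else 0 := by
    refine sum_le_sum fun P _ => ?_
    split_ifs with h
    · simp
    · have : (1 : ℝ) ≤ inside E P := by exact_mod_cast Nat.one_le_iff_ne_zero.2 h
      linarith
  rw [sum_sub_distrib, ← h2, h1, ← h3] at h4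
  linarith

theorem free_le_choose (k : ℕ) : free E V k ≤ (#V).choose k :=
  (card_filter_le _ _).trans (card_powersetCard k V).le

theorem genFun_zero (k : ℕ) : genFun E V k 0 = free E V k / (#V).choose k := by
  unfold genFun free
  congr 1
  simp only [zero_pow_eq]
  simp

theorem genFun_one {k : ℕ} (hk : k ≤ #V) : genFun E V k 1 = 1 := by
  unfold genFun
  simp [(Nat.choose_pos hk).ne']

/-- The truncated exponent is harmless: `R ∪ a` contains `a`, so the count is at least `1`. -/
theorem hasDerivAt_genFun (hE : E ⊆ V.powersetCard 2) (t : ℝ) :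
    HasDerivAt (genFun E V (j + 2))
      ((∑ a ∈ E, ∑ R ∈ (V \ a).powersetCard j, t ^ (inside E (R ∪ a) - 1))
        / (#V).choose (j + 2)) t := by
  rw [← sum_inside_mul hE j fun P => t ^ (inside E P - 1)]
  unfold genFun
  refine HasDerivAt.div_const ?_ _
  exact HasDerivAt.fun_sum fun P _ => hasDerivAt_pow _ _

theorem pow_inside_antitone {t : ℝ} (h0 : 0 ≤ t) (h1 : t ≤ 1) :
    Antitone fun P => t ^ inside E P := fun _ _ h => pow_le_pow_of_le_one h0 h1 (inside_mono E h)

/-- Use `t^Y ≥ 1 - (1 - t) Y`. The main term `t^X(R)` averages to at least `genFun`, since `R` is a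
smaller set; the correction is controlled by `sum_meeting_mul_le`, with `q` bounding the chance of
`X = 0` away from three points. -/
theorem le_deriv_genFun (hE : E ⊆ V.powersetCard 2) (hj : j + 2 ≤ #V) (hM : 0 < #E) {q : ℝ}
    (hq0 : 0 ≤ q) (hq : 1 ≤ j → ∀ T ⊆ V, #T = 3 →
      (free E (V \ T) (j - 1) : ℝ) ≤ q * (#V - 3).choose (j - 1))
    {t : ℝ} (h0 : 0 ≤ t) (h1 : t ≤ 1) :
    rate E #V j * genFun E V (j + 2) t
        - rate E #V j * excess E #V j * ((1 - t) * (t + (1 - t) * q))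
      ≤ (∑ a ∈ E, ∑ R ∈ (V \ a).powersetCard j, t ^ (inside E (R ∪ a) - 1))
        / (#V).choose (j + 2) := by
  have hC := choose_pos_real hj
  have h2 : (2 : ℝ) ≤ #V := by exact_mod_cast (by omega : 2 ≤ #V)
  have ht : 0 ≤ 1 - t := by linarith
  set b : ℝ := (#V - 2).choose j * j / (#V - 2) * (t + (1 - t) * q) with hbdef
  have hb : 0 ≤ b :=
    mul_nonneg (div_nonneg (by positivity) (by linarith)) (by positivity)
  have key : ∀ a ∈ E, (#V - 2).choose j / (#V).choose (j + 2)
        * ∑ P ∈ V.powersetCard (j + 2), t ^ inside E P - (1 - t) * (#(meeting E a) * b)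
      ≤ ∑ R ∈ (V \ a).powersetCard j, t ^ (inside E (R ∪ a) - 1) := by
    intro a ha
    have e1 := average_le hE hj ha (h := fun P => -(t ^ inside E P))
      (pow_inside_antitone h0 h1).neg
    rw [sum_neg_distrib, sum_neg_distrib] at e1
    have e2 := sum_meeting_mul_le hE ha j (pow_inside_antitone (E := E) h0 h1) hb
      fun hj1 T hT hT3 => by
        -- A power of `t` is at most `t` unless its exponent is `0`.
        have e3 : ∑ Q ∈ (V \ T).powersetCard (j - 1), t ^ inside E Q
            ≤ ∑ Q ∈ (V \ T).powersetCard (j - 1),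
              (t + (1 - t) * if inside E Q = 0 then (1 : ℝ) else 0) := by
          refine sum_le_sum fun Q _ => ?_
          split_ifs with h
          · rw [h]; simp
          · simpa using pow_le_of_le_one h0 h1 h
        refine e3.trans ?_
        rw [sum_add_distrib, ← mul_sum, sum_boole, sum_const, nsmul_eq_mul, card_powersetCard,
          card_sdiff_of_subset hT, hT3, hbdef, ← choose_one_step hj hj1]
        have := mul_le_mul_of_nonneg_left (hq hj1 T hT hT3) ht
        unfold free at this
        linarith
    have e4 : ∑ R ∈ (V \ a).powersetCard j, t ^ inside E R - (1 - t)
          * ∑ R ∈ (V \ a).powersetCard j, (#{e ∈ meeting E a | e ⊆ R ∪ a} : ℝ) * t ^ inside E R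
        ≤ ∑ R ∈ (V \ a).powersetCard j, t ^ (inside E (R ∪ a) - 1) := by
      rw [mul_sum, ← sum_sub_distrib]
      refine sum_le_sum fun R hR => ?_
      rw [inside_union hE ha (disjoint_of_subset_left (mem_powersetCard.1 hR).1 sdiff_disjoint),
        show ∀ x y : ℕ, x + 1 + y - 1 = x + y by omega, pow_add]
      have := one_add_mul_le_pow (a := t - 1) (by linarith) #{e ∈ meeting E a | e ⊆ R ∪ a}
      rw [add_sub_cancel] at this
      have := mul_le_mul_of_nonneg_left this (pow_nonneg h0 (inside E R))
      linarith
    have e5 := mul_le_mul_of_nonneg_left e2 ht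
    linarith
  rw [le_div_iff₀ hC]
  refine le_trans (le_of_eq ?_) (sum_le_sum key)
  rw [sum_sub_distrib, ← mul_sum, ← mul_sum, sum_overlaps, sum_const, nsmul_eq_mul,
    rate_mul_excess hj hM, rate_eq hj, hbdef]
  unfold genFun
  field_simp

/-- Drop `t^Y ≤ 1`. As `t^X` decreases in the set, the averaging lemma is applied to `t^X + (1 - t)
X`, which increases; the price is `1 - t` times the gap between the mean of `X(P)` and that of
`X(R)`. -/
theorem deriv_genFun_le (hE : E ⊆ V.powersetCard 2) (hj : j + 2 ≤ #V) (hM : 0 < #E)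
    {t : ℝ} (h0 : 0 ≤ t) (h1 : t ≤ 1) :
    (∑ a ∈ E, ∑ R ∈ (V \ a).powersetCard j, t ^ (inside E (R ∪ a) - 1)) / (#V).choose (j + 2)
      ≤ rate E #V j * genFun E V (j + 2) t + rate E #V j * (1 - t) * (rate E #V j
        - j * (j - 1) / ((#V - 2) * (#V - 3)) * (#E - 1 - overlaps E / #E)) := by
  have hC := choose_pos_real hj
  have hM' : (0 : ℝ) < #E := by exact_mod_cast hM
  set ρ : ℝ := j * (j - 1) / ((#V - 2) * (#V - 3)) with hρ
  have hcount : ∀ a ∈ E, ∑ R ∈ (V \ a).powersetCard j, (inside E R : ℝ)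
      = (#E - 1 - #(meeting E a)) * ((#V - 2).choose j * ρ) := by
    intro a ha
    obtain ⟨haV, ha2⟩ := mem_powersetCard.1 (hE ha)
    -- For `j < 2` no pair fits in `R`, and `j (j - 1) = 0` makes `ρ` vanish whatever its
    -- denominator.
    rcases Nat.lt_or_ge j 2 with h | h
    · have e : ρ = 0 := by
        rw [hρ]
        interval_cases j <;> simp
      rw [e, mul_zero, mul_zero]
      refine sum_eq_zero fun R hR => ?_
      rw [inside, Nat.cast_eq_zero, card_eq_zero, filter_eq_empty_iff]
      intro e he hs
      have := card_le_card hs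
      rw [(mem_powersetCard.1 hR).2, (mem_powersetCard.1 (hE he)).2] at this
      omega
    · obtain ⟨i, rfl⟩ : ∃ i, j = i + 2 := ⟨j - 2, by omega⟩
      rw [sum_inside_sdiff hE ha]
      congr 1
      obtain ⟨n, hn⟩ : ∃ n, #V = n + 2 := ⟨#V - 2, by omega⟩
      have e := choose_two_step (n := n) (j := i) (by omega)
      rw [hρ, hn, show n + 2 - 4 = n - 2 by omega, show n + 2 - 2 = n by omega]
      have h3 : (2 : ℝ) ≤ n := by exact_mod_cast (by omega : 2 ≤ n)
      push_cast
      rw [mul_div_assoc', eq_div_iff (by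
        have : (0 : ℝ) < (n + 2 - 2) * (n + 2 - 3) := by nlinarith
        exact this.ne')]
      linear_combination e
  have key : ∀ a ∈ E, ∑ R ∈ (V \ a).powersetCard j, t ^ (inside E (R ∪ a) - 1)
      ≤ (#V - 2).choose j / (#V).choose (j + 2) * (∑ P ∈ V.powersetCard (j + 2), t ^ inside E P
        + (1 - t) * (rate E #V j * (#V).choose (j + 2)))
        - (1 - t) * ((#E - 1 - #(meeting E a)) * ((#V - 2).choose j * ρ)) := by
    intro a ha
    -- The increment at `n` is `(1 - t) (1 - t ^ n)`.
    have hmono : Monotone fun n : ℕ => t ^ n + (1 - t) * (n : ℝ) :=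
      monotone_nat_of_le_succ fun n => by
        have : t ^ n ≤ 1 := pow_le_one₀ h0 h1
        rw [pow_succ]; push_cast
        nlinarith
    have e1 := average_le hE hj ha (h := fun P => t ^ inside E P + (1 - t) * (inside E P : ℝ))
      fun A B hAB => hmono (inside_mono E hAB)
    rw [sum_add_distrib, sum_add_distrib, ← mul_sum, ← mul_sum, hcount a ha,
      sum_inside_eq_rate hE hj] at e1
    have e2 : ∑ R ∈ (V \ a).powersetCard j, t ^ (inside E (R ∪ a) - 1)
        ≤ ∑ R ∈ (V \ a).powersetCard j, t ^ inside E R := by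
      refine sum_le_sum fun R hR => ?_
      rw [inside_union hE ha (disjoint_of_subset_left (mem_powersetCard.1 hR).1 sdiff_disjoint)]
      exact pow_le_pow_of_le_one h0 h1 (by omega)
    linarith
  rw [div_le_iff₀ hC]
  refine (sum_le_sum key).trans (le_of_eq ?_)
  have e3 : ∑ a ∈ E, (1 - t) * (((#E : ℝ) - 1 - #(meeting E a)) * ((#V - 2).choose j * ρ))
      = (1 - t) * ((#E * (#E - 1) - overlaps E) * ((#V - 2).choose j * ρ)) := by
    rw [← mul_sum, ← sum_mul, sum_sub_distrib, sum_const, nsmul_eq_mul, overlaps]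
    push_cast; rfl
  rw [sum_sub_distrib, e3, sum_const, nsmul_eq_mul, ← mul_assoc, ← rate_eq hj]
  have e4 : (#E : ℝ) * (#V - 2).choose j = (#V).choose (j + 2) * rate E #V j := by
    rw [rate_eq hj]; field_simp
  have e5 : ((#E : ℝ) * (#E - 1) - overlaps E) * ((#V - 2).choose j * ρ)
      = (#V).choose (j + 2) * rate E #V j * ρ * (#E - 1 - overlaps E / #E) := by
    rw [← e4]; field_simp
  rw [e5]
  unfold genFun
  field_simp
  ring

end

/-! ### Integrating the differential inequalities (Grönwall). -/

theorem le_exp_neg_mul {v v' : ℝ → ℝ} {c : ℝ} (hv : ∀ t, HasDerivAt v (v' t) t)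
    (h : ∀ t, 0 ≤ t → t ≤ 1 → c * v t ≤ v' t) : v 0 ≤ Real.exp (-c) * v 1 := by
  have hd : ∀ t, HasDerivAt (fun t => Real.exp (-c * t) * v t)
      (Real.exp (-c * t) * (v' t - c * v t)) t := fun t => by
    have h1 : HasDerivAt (fun t => Real.exp (-c * t)) (Real.exp (-c * t) * (-c)) t := by
      simpa using ((hasDerivAt_id t).const_mul (-c)).exp
    exact (h1.mul (hv t)).congr_deriv (by ring)
  have hm : MonotoneOn (fun t => Real.exp (-c * t) * v t) (Set.Icc 0 1) := by
    refine monotoneOn_of_deriv_nonneg (convex_Icc 0 1)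
      (fun t _ => (hd t).continuousAt.continuousWithinAt)
      (fun t _ => (hd t).differentiableAt.differentiableWithinAt) fun t ht => ?_
    rw [interior_Icc] at ht
    rw [(hd t).deriv]
    exact mul_nonneg (Real.exp_pos _).le (sub_nonneg.2 (h t ht.1.le ht.2.le))
  have := hm (Set.left_mem_Icc.2 zero_le_one) (Set.right_mem_Icc.2 zero_le_one) zero_le_one
  simpa using this

/-- `K (t + 1/c - 1)` solves `w' = c w + c (1 - t) K`; its difference with `φ` satisfies the
homogeneous inequality. -/
theorem le_of_deriv_le {φ φ' : ℝ → ℝ} {c K : ℝ} (hc : 0 < c) (hφ : ∀ t, HasDerivAt φ (φ' t) t)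
    (h1 : φ 1 = 1) (h : ∀ t, 0 ≤ t → t ≤ 1 → φ' t ≤ c * φ t + c * (1 - t) * K) :
    Real.exp (-c) - K * (1 - (1 - Real.exp (-c)) / c) ≤ φ 0 := by
  have := le_exp_neg_mul (v := fun t => K * (t + 1 / c - 1) - φ t) (v' := fun t => K - φ' t) (c := c)
    (fun t => by
      have := ((((hasDerivAt_id t).add_const (1 / c)).sub_const 1).const_mul K).sub (hφ t)
      exact this.congr_deriv (by simp))
    (fun t ht0 ht1 => by
      have e : c * (K * (t + 1 / c - 1) - φ t) = K - (c * φ t + c * (1 - t) * K) := by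
        field_simp; ring
      rw [e]
      linarith [h t ht0 ht1])
  rw [h1] at this
  have e : K * (1 - (1 - Real.exp (-c)) / c)
      = Real.exp (-c) * (K * (1 / c)) - K * (1 / c - 1) := by field_simp; ring
  rw [e]
  ring_nf at this ⊢
  linarith

/-- Expand `(1 - t)(t + (1 - t) q) = (1 - t) - (1 - q)(1 - t)²`. The linear and quadratic
polynomials added to `φ` are particular solutions for the two forcing terms. -/
theorem le_of_le_deriv {φ φ' : ℝ → ℝ} {c u q : ℝ} (hc : 0 < c) (hφ : ∀ t, HasDerivAt φ (φ' t) t)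
    (h1 : φ 1 = 1)
    (h : ∀ t, 0 ≤ t → t ≤ 1 → c * φ t - c * u * ((1 - t) * (t + (1 - t) * q)) ≤ φ' t) :
    φ 0 ≤ Real.exp (-c) + u * ((1 - (1 - Real.exp (-c)) / c)
      - (1 - q) * (1 - 2 / c * (1 - (1 - Real.exp (-c)) / c))) := by
  have := le_exp_neg_mul (c := c)
    (v := fun t => φ t + u * ((t + 1 / c - 1)
      - (1 - q) * (-t ^ 2 + (2 - 2 / c) * t + (2 / c - 2 / c ^ 2 - 1))))
    (v' := fun t => φ' t + u * (1 - (1 - q) * (-(2 * t) + (2 - 2 / c))))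
    (fun t => by
      have a1 := ((hasDerivAt_id t).add_const (1 / c)).sub_const 1
      have a2 := (((hasDerivAt_pow 2 t).neg).add ((hasDerivAt_id t).const_mul (2 - 2 / c))).add_const
        (2 / c - 2 / c ^ 2 - 1)
      have := (hφ t).add ((a1.sub (a2.const_mul (1 - q))).const_mul u)
      exact this.congr_deriv (by simp))
    (fun t ht0 ht1 => by
      have e : c * (φ t + u * ((t + 1 / c - 1)
          - (1 - q) * (-t ^ 2 + (2 - 2 / c) * t + (2 / c - 2 / c ^ 2 - 1))))
          = (c * φ t - c * u * ((1 - t) * (t + (1 - t) * q)))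
            + u * (1 - (1 - q) * (-(2 * t) + (2 - 2 / c))) := by
        field_simp; ring
      rw [e]
      linarith [h t ht0 ht1])
  rw [h1] at this
  have e : Real.exp (-c) + u * ((1 - (1 - Real.exp (-c)) / c)
      - (1 - q) * (1 - 2 / c * (1 - (1 - Real.exp (-c)) / c)))
      = Real.exp (-c) * (1 + u * ((1 + 1 / c - 1)
      - (1 - q) * (-1 ^ 2 + (2 - 2 / c) * 1 + (2 / c - 2 / c ^ 2 - 1))))
      - u * ((0 + 1 / c - 1) - (1 - q) * (-0 ^ 2 + (2 - 2 / c) * 0 + (2 / c - 2 / c ^ 2 - 1))) := by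
    field_simp; ring
  rw [e]
  linarith

end PairCount

/-! ### Elementary inequalities for the integrated error. -/

namespace PairCount

theorem one_sub_exp_neg_bounds {c : ℝ} (hc : 0 < c) :
    (c + c ^ 2 / 2) / (1 + c + c ^ 2 / 2) ≤ 1 - Real.exp (-c) ∧ c - c ^ 2 / 2 ≤ 1 - Real.exp (-c) ∧
      1 - Real.exp (-c) ≤ c ∧ 1 - Real.exp (-c) < 1 := by
  have h1 := Real.quadratic_le_exp_of_nonneg hc.le
  have h0 : 0 < 1 + c + c ^ 2 / 2 := by positivity
  refine ⟨?_, ?_, ?_, ?_⟩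
  · have e : (c + c ^ 2 / 2) / (1 + c + c ^ 2 / 2) = 1 - (1 + c + c ^ 2 / 2)⁻¹ := by
      field_simp; ring
    rw [e, Real.exp_neg]
    gcongr
  · have h2 : Real.exp (-c) ≤ (1 + c + c ^ 2 / 2)⁻¹ := by
      rw [Real.exp_neg]; gcongr
    have h3 : (1 + c + c ^ 2 / 2)⁻¹ ≤ 1 - c + c ^ 2 / 2 := by
      rw [inv_le_iff_one_le_mul₀ h0]
      nlinarith [pow_pos hc 4]
    linarith
  · linarith [Real.add_one_le_exp (-c)]
  · linarith [Real.exp_pos (-c)]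

/-- `c⁻¹ (c - 1 + e⁻ᶜ) ≤ min (1, c / 2)`. -/
theorem gap_bounds {c : ℝ} (hc : 0 < c) :
    0 ≤ 1 - (1 - Real.exp (-c)) / c ∧ 1 - (1 - Real.exp (-c)) / c ≤ 1 ∧
      1 - (1 - Real.exp (-c)) / c ≤ c / 2 := by
  obtain ⟨-, h1, h2, -⟩ := one_sub_exp_neg_bounds hc
  refine ⟨?_, ?_, ?_⟩
  · rw [sub_nonneg, div_le_one hc]; exact h2
  · have : 0 ≤ (1 - Real.exp (-c)) / c :=
      div_nonneg (by linarith [Real.exp_le_one_iff.2 (neg_nonpos.2 hc.le)]) hc.le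
    linarith
  · have : (c - c ^ 2 / 2) / c ≤ (1 - Real.exp (-c)) / c := by gcongr
    have e : (c - c ^ 2 / 2) / c = 1 - c / 2 := by field_simp
    linarith

/-- Serves when `c < 6 s`, where the second moment gives no gain. -/
theorem two_mul_gap_sub_one_le {c : ℝ} (hc : 1 ≤ c) :
    2 * (1 - (1 - Real.exp (-c)) / c) - 1 ≤ c / 6 := by
  have h0 : 0 < c := by linarith
  obtain ⟨h1, -, -, -⟩ := one_sub_exp_neg_bounds h0
  have h2 : (c + c ^ 2 / 2) / (1 + c + c ^ 2 / 2) / c ≤ (1 - Real.exp (-c)) / c := by gcongr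
  have h3 : (1 - c / 6) / 2 ≤ (c + c ^ 2 / 2) / (1 + c + c ^ 2 / 2) / c := by
    rw [div_div, le_div_iff₀ (by positivity)]
    nlinarith [sq_nonneg (c ^ 2 - 3 * c), sq_nonneg (c - 2), sq_nonneg (c - 3), sq_nonneg (c ^ 2 - 6),
      mul_nonneg h0.le (sq_nonneg (c - 2)), mul_nonneg h0.le (sq_nonneg (c - 3))]
  linarith

/-- The case `s = 0` of the upper error: `1 - q = c / (3 + c)` recovers the factor two. -/
theorem two_mul_gap_sub_one_le' {c : ℝ} (hc : 1 ≤ c) :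
    (2 * (1 - (1 - Real.exp (-c)) / c) - 1) * (3 + c)
      ≤ 2 * c * (1 - 2 / c * (1 - (1 - Real.exp (-c)) / c)) := by
  have h0 : 0 < c := by linarith
  obtain ⟨h1, -, -, -⟩ := one_sub_exp_neg_bounds h0
  set e := 1 - Real.exp (-c)
  have h2 : (7 - c) * c ≤ e * (2 * c + 10) := by
    refine le_trans ?_ (mul_le_mul_of_nonneg_right h1 (by positivity))
    rw [div_mul_eq_mul_div, le_div_iff₀ (by positivity)]
    have : 0 ≤ c * ((c + c ^ 2 / 2) / c * (2 * c + 10) - (7 - c) * (1 + c + c ^ 2 / 2)) := by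
      refine mul_nonneg h0.le ?_
      have : (c + c ^ 2 / 2) / c = 1 + c / 2 := by field_simp
      rw [this]
      nlinarith [sq_nonneg (c - 2), mul_nonneg h0.le (sq_nonneg (c - 2))]
    have e2 : c * ((c + c ^ 2 / 2) / c * (2 * c + 10) - (7 - c) * (1 + c + c ^ 2 / 2))
      = (c + c ^ 2 / 2) * (2 * c + 10) - (7 - c) * c * (1 + c + c ^ 2 / 2) := by field_simp
    linarith
  have h3 : 7 - c ≤ e * (2 * c + 10) / c := by rw [le_div_iff₀ h0]; exact h2
  have e3 : e * (2 * c + 10) / c = 2 * e + 10 * (e / c) := by field_simp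
  have e4 : 2 * c * (1 - 2 / c * (1 - e / c)) = 2 * c - 4 * (1 - e / c) := by
    field_simp; ring
  have e5 : e / c * c = e := by field_simp
  rw [e4]
  nlinarith

/-- The refined upper error, with `2 y` the excess and `s` the rest of the error term. -/
theorem upper_error_le {c y s q : ℝ} (hc : 0 < c) (hy : 0 ≤ y) (hs : 0 ≤ s) (hys : y + s ≤ 1)
    (hq : s < 1 / 2 → 6 * s ≤ c → q ≤ 1 - (c - 6 * s) / (3 + c)) (hq1 : q ≤ 1) :
    2 * y * ((1 - (1 - Real.exp (-c)) / c)
      - (1 - q) * (1 - 2 / c * (1 - (1 - Real.exp (-c)) / c))) ≤ min (y + s) (c * (y + s)) := by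
  obtain ⟨g0, g1, g2⟩ := gap_bounds hc
  have hB : 0 ≤ 1 - 2 / c * (1 - (1 - Real.exp (-c)) / c) := by
    have : 2 / c * (1 - (1 - Real.exp (-c)) / c) ≤ 2 / c * (c / 2) := by gcongr
    have e : 2 / c * (c / 2) = 1 := by field_simp
    linarith
  set g := 1 - (1 - Real.exp (-c)) / c with hg
  set B := 1 - 2 / c * g with hBdef
  have hqB : 0 ≤ (1 - q) * B := mul_nonneg (by linarith) hB
  have h2g : 2 * y * (g - (1 - q) * B) ≤ 2 * y * g := by
    have := mul_nonneg hy hqB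
    linarith
  -- For `c ≤ 1` the bound `g ≤ c / 2` already wins the factor two.
  rcases le_total c 1 with h | h
  · have e1 : 2 * y * g ≤ c * y := by nlinarith
    have e2 : c * y ≤ c * (y + s) := by nlinarith
    exact le_min (by nlinarith) (by linarith)
  suffices hmain : 2 * y * (g - (1 - q) * B) ≤ y + s from
    le_min hmain (by nlinarith)
  -- If `s ≥ 1/2`, then `y ≤ 1 - s ≤ s`, so `2 y ≤ y + s`.
  rcases le_or_gt (1 / 2) s with h1 | h1
  · nlinarith
  have hf1 := two_mul_gap_sub_one_le h
  have hf2 := two_mul_gap_sub_one_le' h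
  rw [← hg] at hf1 hf2
  rw [← hBdef] at hf2
  suffices h3 : 2 * (g - (1 - q) * B) - 1 ≤ s by
    have hy1 : y ≤ 1 := by linarith
    have := mul_le_mul_of_nonneg_left h3 hy
    nlinarith
  rcases lt_or_ge c (6 * s) with h4 | h4
  · linarith
  have hq' := hq h1 h4
  have h5 : (c - 6 * s) / (3 + c) * B ≤ (1 - q) * B :=
    mul_le_mul_of_nonneg_right (by linarith) hB
  -- Split `2 g - 1` in proportions `1 - 6 s / c` and `6 s / c`: the first part is covered by `hf2`,
  -- the second by `hf1`, which turns it into at most `s`.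
  have h6 : 2 * g - 1 - s ≤ 2 * ((c - 6 * s) / (3 + c) * B) := by
    have e : 2 * ((c - 6 * s) / (3 + c) * B) = (2 * c * B) / (3 + c) * ((c - 6 * s) / c) := by
      field_simp
    rw [e]
    have h7 : 2 * g - 1 ≤ 2 * c * B / (3 + c) := by
      rw [le_div_iff₀ (by linarith)]; exact hf2
    have h8 : 0 ≤ (c - 6 * s) / c := div_nonneg (by linarith) hc.le
    refine le_trans ?_ (mul_le_mul_of_nonneg_right h7 h8)
    have e2 : (c - 6 * s) / c = 1 - 6 * s / c := by field_simp
    rw [e2]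
    have h9 : (2 * g - 1) * (6 * s / c) ≤ c / 6 * (6 * s / c) := by gcongr
    have e3 : c / 6 * (6 * s / c) = s := by field_simp
    linarith
  linarith

/-! ### Probability of no pair away from three points. -/

theorem one_le_cube {κ s : ℝ} (h0 : 0 ≤ κ) (hs : 2 * κ + 6 * κ ^ 2 ≤ s) (h : s < 1 / 2) :
    1 ≤ (1 + 3 / 2 * s) * (1 - κ) ^ 3 := by
  have h1 : κ ≤ 1 / 6 := by nlinarith
  have h2 : 1 ≤ (1 + 3 / 2 * (2 * κ + 6 * κ ^ 2)) * (1 - κ) ^ 3 := by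
    have e : (1 + 3 / 2 * (2 * κ + 6 * κ ^ 2)) * (1 - κ) ^ 3 - 1
      = κ ^ 2 * (3 - 19 * κ + 24 * κ ^ 2 - 9 * κ ^ 3) := by ring
    have : 0 ≤ 3 - 19 * κ + 24 * κ ^ 2 - 9 * κ ^ 3 := by
      nlinarith [mul_nonneg h0 (sq_nonneg κ), mul_nonneg (sq_nonneg κ) (by linarith : 0 ≤ 1 / 6 - κ),
        sq_nonneg (κ - 1/6)]
    nlinarith [mul_nonneg (sq_nonneg κ) this]
  refine h2.trans (mul_le_mul_of_nonneg_right (by linarith) (pow_nonneg (by linarith) 3))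

/-- The quotient of the binomials is a product of three factors `1 - i/n`, `1 - i/(n-1)`, `1 -
i/(n-2)`, the last being the least. -/
theorem choose_mul_cube_le {n i : ℕ} (h : i + 3 ≤ n) :
    (n.choose i : ℝ) * (1 - i / (n - 2)) ^ 3 ≤ (n - 3).choose i := by
  obtain ⟨m, rfl⟩ : ∃ m, n = m + 3 := ⟨n - 3, by omega⟩
  have him : i ≤ m := by omega
  have h1 : (m.choose i : ℝ) * (m + 1) = (m + 1).choose i * (m + 1 - i) := by
    have := Nat.choose_mul_succ_eq m i
    zify [show i ≤ m + 1 by omega] at this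
    exact_mod_cast this
  have h2 : ((m + 1).choose i : ℝ) * (m + 2) = (m + 2).choose i * (m + 2 - i) := by
    have := Nat.choose_mul_succ_eq (m + 1) i
    zify [show i ≤ m + 1 + 1 by omega] at this
    exact_mod_cast this
  have h3 : ((m + 2).choose i : ℝ) * (m + 3) = (m + 3).choose i * (m + 3 - i) := by
    have := Nat.choose_mul_succ_eq (m + 2) i
    zify [show i ≤ m + 2 + 1 by omega] at this
    exact_mod_cast this
  have hm : (0 : ℝ) ≤ m := m.cast_nonneg
  have hi : (0 : ℝ) ≤ i := i.cast_nonneg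
  have him' : (i : ℝ) ≤ m := by exact_mod_cast him
  set x : ℝ := 1 - i / (m + 1) with hx
  have hx0 : 0 ≤ x := by
    rw [hx, sub_nonneg, div_le_one (by linarith)]; linarith
  have hx1 : (m + 1 : ℝ) - i = (m + 1) * x := by rw [hx]; field_simp
  have hxi : (1 - x) * (m + 1) = i := by rw [hx]; field_simp; ring
  have hx' : x ≤ 1 := by
    rw [hx]; have : (0 : ℝ) ≤ i / (m + 1) := by positivity
    linarith
  have e1 : (m.choose i : ℝ) = (m + 1).choose i * x := by
    rw [hx1] at h1
    have : (m + 1 : ℝ) ≠ 0 := by positivity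
    field_simp at h1 ⊢
    linarith
  have e2 : ((m + 2).choose i : ℝ) * x ≤ (m + 1).choose i := by
    refine le_of_mul_le_mul_right ?_ (by linarith : (0 : ℝ) < m + 2)
    rw [h2]
    have : x * (m + 2) ≤ m + 2 - i := by linarith
    nlinarith [mul_le_mul_of_nonneg_left this (Nat.cast_nonneg (α := ℝ) ((m + 2).choose i))]
  have e3 : ((m + 3).choose i : ℝ) * x ≤ (m + 2).choose i := by
    refine le_of_mul_le_mul_right ?_ (by linarith : (0 : ℝ) < m + 3)
    rw [h3]
    have : x * (m + 3) ≤ m + 3 - i := by linarith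
    nlinarith [mul_le_mul_of_nonneg_left this (Nat.cast_nonneg (α := ℝ) ((m + 3).choose i))]
  have e4 : ((m + 3 : ℕ) : ℝ) - 2 = m + 1 := by push_cast; ring
  rw [e4, ← hx, Nat.add_sub_cancel, e1]
  calc ((m + 3).choose i : ℝ) * x ^ 3 = ((m + 3).choose i * x) * x * x := by ring
    _ ≤ (m + 2).choose i * x * x := by gcongr
    _ ≤ _ := by gcongr

variable {α : Type*} [DecidableEq α] {V : Finset α} {E : Finset (Finset α)} {j : ℕ}

theorem free_mono {U : Finset α} (h : U ⊆ V) (k : ℕ) : free E U k ≤ free E V k :=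
  card_le_card (filter_subset_filter _ (powersetCard_mono h))

/-- Second moment bound with `excess ≤ 2`, which passes to smaller sets because `excess` increases
with `j`. For `i < 2` the rate term is `0`. -/
theorem free_mul_le (hE : E ⊆ V.powersetCard 2) (hM : 0 < #E) {i : ℕ} (hij : i ≤ j + 2)
    (hi : j + 2 ≤ #V) (he : excess E #V j ≤ 2) :
    (free E V i : ℝ) * (3 + #E * (i * (i - 1)) / (#V * (#V - 1))) ≤ 3 * (#V).choose i := by
  have hle : (free E V i : ℝ) ≤ (#V).choose i := by exact_mod_cast free_le_choose i
  rcases Nat.lt_or_ge i 2 with h | h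
  · have e : (i : ℝ) * (i - 1) = 0 := by interval_cases i <;> simp
    rw [e]; simp; linarith
  obtain ⟨l, rfl⟩ : ∃ l, i = l + 2 := ⟨i - 2, by omega⟩
  have h1 := rate_le_of_second_moment (j := l) hE (by omega) hM
  have h2 : (2 : ℝ) ≤ #V := by exact_mod_cast (by omega : 2 ≤ #V)
  have h3 : excess E #V l ≤ excess E #V j := by
    unfold excess
    have : (l : ℝ) ≤ j := by exact_mod_cast (by omega : l ≤ j)
    have : (0 : ℝ) ≤ #V - 2 := by linarith
    gcongr
  have h4 : (#E : ℝ) * ((l + 2 : ℕ) * ((l + 2 : ℕ) - 1)) / (#V * (#V - 1)) = rate E #V l := by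
    unfold rate; push_cast; ring
  rw [h4]
  have h5 : rate E #V l * (#V).choose (l + 2) ≤
      ((#V).choose (l + 2) - free E V (l + 2)) * (rate E #V l + 3) :=
    h1.trans (mul_le_mul_of_nonneg_left (by linarith) (by linarith))
  linarith

/-- Restore the three points, apply `free_mul_le` to `(j - 1)`-sets, then pay for the change of
binomial (`one_le_cube`) and for the drop in rate from size `j + 2` to `j - 1`. -/
theorem free_sdiff_le (hE : E ⊆ V.powersetCard 2) (hM : 0 < #E) (hj : j + 2 ≤ #V) (hj1 : 1 ≤ j)
    {s : ℝ} (h2j : 2 * j + 1 ≤ #V) (he : excess E #V j ≤ 2) (hs : s < 1 / 2)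
    (hsr : 6 * s ≤ rate E #V j) (hs1 : (2 * j + 1) * #E / ((#V).choose 2 : ℝ) ≤ s)
    (hs2 : (3 * j ^ 2 + 1) / ((#V).choose 2 : ℝ) + 2 * ((j - 1) / (#V - 2)) ≤ s)
    {T : Finset α} :
    (free E (V \ T) (j - 1) : ℝ)
      ≤ (1 - (rate E #V j - 6 * s) / (3 + rate E #V j)) * (#V - 3).choose (j - 1) := by
  obtain ⟨i, rfl⟩ : ∃ i, j = i + 1 := ⟨j - 1, by omega⟩
  have hN : (3 : ℝ) ≤ #V := by exact_mod_cast (by omega : 3 ≤ #V)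
  have hi : (0 : ℝ) ≤ i := i.cast_nonneg
  have hNi : 2 * (i : ℝ) + 3 ≤ #V := by exact_mod_cast (by omega : 2 * i + 3 ≤ #V)
  have hMr : (0 : ℝ) < #E := by exact_mod_cast hM
  rw [Nat.cast_choose_two] at hs1 hs2
  rw [Nat.add_sub_cancel]
  push_cast at hs1 hs2
  set N : ℝ := ((#V : ℕ) : ℝ) with hNdef
  have hNN : 0 < N * (N - 1) := by nlinarith
  set κ : ℝ := i / (N - 2) with hκ
  have hκ0 : 0 ≤ κ := div_nonneg hi (by linarith)
  have hκs : 2 * κ + 6 * κ ^ 2 ≤ s := by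
    -- `2 j + 1 ≤ #V` gives `κ ≤ j / #V`, so the second-order term fits inside the `s4` term.
    have e1 : 6 * κ ^ 2 ≤ (3 * ((i : ℝ) + 1) ^ 2 + 1) / (N * (N - 1) / 2) := by
      have hle : κ ≤ (i + 1) / N := by
        rw [hκ, div_le_div_iff₀ (by linarith) (by linarith)]
        nlinarith
      have h1 : κ ^ 2 ≤ ((i + 1) / N) ^ 2 := by gcongr
      refine (mul_le_mul_of_nonneg_left h1 (by norm_num)).trans ?_
      rw [div_pow, mul_div_assoc', div_le_div_iff₀ (by positivity) (by linarith)]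
      nlinarith [sq_nonneg ((i : ℝ) + 1), mul_nonneg (sq_nonneg ((i : ℝ) + 1)) (by linarith : 0 ≤ N),
        sq_nonneg N]
    have e2 : ((i : ℝ) + 1 - 1) / (N - 2) = κ := by rw [hκ]; ring
    rw [e2] at hs2
    linarith
  have hcube := one_le_cube hκ0 hκs hs
  have h1 := choose_mul_cube_le (n := #V) (i := i) (by omega)
  rw [← hNdef, ← hκ] at h1
  have hs0 : 0 ≤ s := by nlinarith
  have h2 : ((#V).choose i : ℝ) ≤ (1 + 3 / 2 * s) * (#V - 3).choose i := by
    calc ((#V).choose i : ℝ) = (#V).choose i * 1 := (mul_one _).symm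
      _ ≤ (#V).choose i * ((1 + 3 / 2 * s) * (1 - κ) ^ 3) := by gcongr
      _ = (1 + 3 / 2 * s) * ((#V).choose i * (1 - κ) ^ 3) := by ring
      _ ≤ _ := by gcongr
  have h3 := free_mul_le hE hM (i := i) (j := i + 1) (by omega) hj he
  rw [← hNdef] at h3
  set r'' : ℝ := #E * (i * (i - 1)) / (N * (N - 1)) with hr''
  -- `(i + 3)(i + 2) - i (i - 1) = 6 (i + 1)`, at most `3/2` of the coefficient `4 (i + 1) + 2` in
  -- `hs1`.
  have h4 : rate E #V (i + 1) - 3 / 2 * s ≤ r'' := by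
    have e : rate E #V (i + 1) = r'' + #E * (6 * (i + 1)) / (N * (N - 1)) := by
      rw [hr'']; unfold rate; push_cast; rw [← hNdef, ← add_div]; congr 1; ring
    have e2 : (2 * ((i : ℝ) + 1) + 1) * #E / (N * (N - 1) / 2)
        = #E * (4 * (i + 1) + 2) / (N * (N - 1)) := by
      field_simp; ring
    have e3 : 3 / 2 * (#E * (4 * ((i : ℝ) + 1) + 2) / (N * (N - 1)))
        = #E * (6 * (i + 1)) / (N * (N - 1)) + 3 * #E / (N * (N - 1)) := by ring
    have e4 : 0 ≤ 3 * (#E : ℝ) / (N * (N - 1)) := by positivity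
    rw [e2] at hs1
    linarith
  have h5 : (free E (V \ T) i : ℝ) ≤ free E V i := by exact_mod_cast free_mono sdiff_subset i
  refine h5.trans ?_
  set r := rate E #V (i + 1)
  have hr3 : 0 < 3 + r := by linarith
  have e5 : 1 - (r - 6 * s) / (3 + r) = (3 + 6 * s) / (3 + r) := by field_simp; ring
  have hr0 : 0 < 3 + r'' := by linarith
  rw [e5, div_mul_eq_mul_div, le_div_iff₀ hr3]
  refine le_of_mul_le_mul_right ?_ hr0
  have hC : (0 : ℝ) ≤ (#V - 3).choose i := by positivity
  -- With `r'' ≥ r - 3 s / 2`, the difference is at least `(3/2) s (r - 6 s)`.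
  have h6 : (3 + 9 / 2 * s) * (3 + r) ≤ (3 + 6 * s) * (3 + r'') := by
    nlinarith [mul_nonneg hs0 (by linarith : 0 ≤ r - 6 * s)]
  calc (free E V i : ℝ) * (3 + r) * (3 + r'') = free E V i * (3 + r'') * (3 + r) := by ring
    _ ≤ 3 * (#V).choose i * (3 + r) := by gcongr
    _ ≤ 3 * ((1 + 3 / 2 * s) * (#V - 3).choose i) * (3 + r) := by gcongr
    _ = (3 + 9 / 2 * s) * (3 + r) * (#V - 3).choose i := by ring
    _ ≤ (3 + 6 * s) * (3 + r'') * (#V - 3).choose i := by gcongr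
    _ = _ := by ring

/-- `(j + 2)(j + 1) = j (j - 1) + (4 j + 2)` isolates the first term of the bound. The overlap term
is `excess` times `(j - 1)/(#V - 3)`, and `2 j + 1 ≤ #V` makes that factor at most `1/2`: this is
where half the excess comes from. -/
theorem lower_slope_le (hM : 0 < #E) (hj : j + 2 ≤ #V) (h2j : 2 * j + 1 ≤ #V) :
    rate E #V j - j * (j - 1) / ((#V - 2) * (#V - 3)) * (#E - 1 - overlaps E / #E)
      ≤ excess E #V j / 2 + ((2 * j + 1) * #E / ((#V).choose 2 : ℝ)
        + (3 * j ^ 2 + 1) / ((#V).choose 2 : ℝ)) := by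
  have hMr : (0 : ℝ) < #E := by exact_mod_cast hM
  have hj0 : (0 : ℝ) ≤ j := j.cast_nonneg
  have hN2 : (2 : ℝ) ≤ #V := by exact_mod_cast (by omega : 2 ≤ #V)
  have hNj : 2 * (j : ℝ) + 1 ≤ #V := by exact_mod_cast h2j
  rw [Nat.cast_choose_two]
  have hNN : (0 : ℝ) < #V * (#V - 1) := by nlinarith
  have hr : rate E #V j
      = (2 * j + 1) * #E / (#V * (#V - 1) / 2) + #E * (j * (j - 1)) / (#V * (#V - 1)) := by
    unfold rate; field_simp; ring
  have he : 0 ≤ excess E #V j := by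
    unfold excess
    have : (0 : ℝ) ≤ #V - 2 := by linarith
    positivity
  have hs4 : (0 : ℝ) ≤ (3 * j ^ 2 + 1) / (#V * (#V - 1) / 2) := by positivity
  rw [hr]
  rcases Nat.lt_or_ge j 2 with h | h
  · have e : (j : ℝ) * (j - 1) = 0 := by interval_cases j <;> simp
    rw [e]; simp; linarith
  have hj2 : (2 : ℝ) ≤ j := by exact_mod_cast h
  set N : ℝ := ((#V : ℕ) : ℝ) with hN
  have h3 : 0 < (N - 2) * (N - 3) := by nlinarith
  have hjj : 0 ≤ (j : ℝ) * (j - 1) := by nlinarith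
  have h4 : #E * (j * (j - 1)) / (N * (N - 1)) ≤ j * (j - 1) / ((N - 2) * (N - 3)) * #E := by
    rw [div_mul_eq_mul_div, mul_comm (#E : ℝ)]
    gcongr <;> linarith
  have h5 : j * (j - 1) / ((N - 2) * (N - 3)) ≤ (3 * (j : ℝ) ^ 2 + 1) / (N * (N - 1) / 2) := by
    rw [div_le_div_iff₀ h3 (by linarith)]
    -- Equality holds at `N = 4`; here `N ≥ 5`.
    have h6 : N * (N - 1) ≤ 6 * ((N - 2) * (N - 3)) := by nlinarith
    have h7 := mul_le_mul_of_nonneg_left h6 hjj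
    nlinarith
  have h8 : j * (j - 1) / ((N - 2) * (N - 3)) * (overlaps E / #E) ≤ excess E #V j / 2 := by
    have e1 : j * (j - 1) / ((N - 2) * (N - 3)) * (overlaps E / #E)
        = excess E #V j * ((j - 1) / (N - 3)) := by
      unfold excess
      rw [← hN]
      have : N - 2 ≠ 0 := by intro h; linarith
      have : N - 3 ≠ 0 := by intro h; linarith
      field_simp
    have e2 : ((j : ℝ) - 1) / (N - 3) ≤ 1 / 2 := by
      rw [div_le_div_iff₀ (by linarith) (by norm_num)]; linarith
    rw [e1]
    have := mul_le_mul_of_nonneg_left e2 he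
    linarith
  linarith

/-- Poisson approximation of the probability that a random `(j + 2)`-subset of `V` contains none of
the pairs in `E`. -/
theorem abs_free_sub_exp_le (hE : E ⊆ V.powersetCard 2) (hj : j + 2 ≤ #V) {d s : ℝ}
    (hs1 : (2 * j + 1) * #E / ((#V).choose 2 : ℝ) + (3 * j ^ 2 + 1) / ((#V).choose 2 : ℝ) ≤ s)
    (hs2 : 0 < #E → s < 1 →
      (3 * j ^ 2 + 1) / ((#V).choose 2 : ℝ) + 2 * ((j - 1) / (#V - 2)) ≤ s)
    (hd : excess E #V j / 2 + s ≤ d) :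
    |free E V (j + 2) / (#V).choose (j + 2) - Real.exp (-rate E #V j)|
      ≤ min d (min (rate E #V j * d) 1) := by
  have hC := choose_pos_real hj
  have hN2 : (2 : ℝ) ≤ #V := by exact_mod_cast (by omega : 2 ≤ #V)
  have hr := rate_nonneg (E := E) hj
  have he : 0 ≤ excess E #V j := by
    unfold excess
    have : (0 : ℝ) ≤ #V - 2 := by linarith
    positivity
  have ha : (0 : ℝ) ≤ (2 * j + 1) * #E / ((#V).choose 2 : ℝ) := by positivity
  have hb : (0 : ℝ) ≤ (3 * j ^ 2 + 1) / ((#V).choose 2 : ℝ) := by positivity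
  have hs0 : 0 ≤ s := by linarith
  have hd0 : 0 ≤ d := by linarith
  set p : ℝ := free E V (j + 2) / (#V).choose (j + 2) with hp
  have hp0 : 0 ≤ p := by positivity
  have hp1 : p ≤ 1 := by
    rw [hp, div_le_one hC]; exact_mod_cast free_le_choose _
  have hpr : 1 - rate E #V j ≤ p := by
    rw [hp, le_div_iff₀ hC]; linarith [free_add_sum_inside_ge hE hj]
  have hx0 := Real.exp_pos (-rate E #V j)
  have hx1 : Real.exp (-rate E #V j) ≤ 1 := Real.exp_le_one_iff.2 (by linarith)
  have hxr := Real.add_one_le_exp (-rate E #V j)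
  have htriv1 : |p - Real.exp (-rate E #V j)| ≤ 1 := abs_le.2 ⟨by linarith, by linarith⟩
  have htriv2 : |p - Real.exp (-rate E #V j)| ≤ rate E #V j := abs_le.2 ⟨by linarith, by linarith⟩
  rw [← min_assoc]
  refine le_min ?_ htriv1
  -- For `d ≥ 1` the trivial bounds by `1` and by `rate` suffice. Otherwise `excess < 2` and `s <
  -- 1`, as the second moment argument needs.
  rcases le_or_gt 1 d with h | hd1
  · exact le_min (htriv1.trans h) (htriv2.trans (by nlinarith))
  rcases Nat.eq_zero_or_pos #E with hM | hM
  · have e : rate E #V j = 0 := by unfold rate; rw [hM]; simp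
    rw [e] at htriv2 ⊢
    exact le_min (htriv2.trans hd0) (by simpa using htriv2)
  have hMr : (0 : ℝ) < #E := by exact_mod_cast hM
  have hNN : (0 : ℝ) < #V * (#V - 1) := by nlinarith
  have hr0 : 0 < rate E #V j := by
    unfold rate; exact div_pos (by positivity) hNN
  -- If `#V ≤ 2 j`, then `(#V).choose 2 ≤ 2 j²` and the `s4` term alone exceeds `1`.
  have h2j : 2 * j + 1 ≤ #V := by
    by_contra hcon
    have h1 : (#V : ℝ) ≤ 2 * j := by exact_mod_cast (by omega : #V ≤ 2 * j)
    have h2 : (3 * (j : ℝ) ^ 2 + 1) / ((#V).choose 2 : ℝ) < 1 := by linarith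
    rw [Nat.cast_choose_two, div_lt_one (by linarith)] at h2
    have h3 : (#V : ℝ) * (#V - 1) ≤ 2 * j * (2 * j) := by gcongr <;> linarith
    linarith [sq_nonneg (j : ℝ)]
  obtain ⟨g0, g1, g2⟩ := gap_bounds hr0
  have hφ1 := genFun_one (E := E) hj
  have hφ0 := genFun_zero (E := E) (V := V) (j + 2)
  rw [← hp] at hφ0
  have hlow := le_of_deriv_le hr0 (hasDerivAt_genFun hE) hφ1
    fun t ht0 ht1 => deriv_genFun_le hE hj hM ht0 ht1
  rw [hφ0] at hlow
  have hK := (lower_slope_le hM hj h2j).trans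
    ((add_le_add_right hs1 (excess E #V j / 2)).trans hd)
  have hlow2 := mul_le_mul_of_nonneg_right hK g0
  -- Outside the regime of `free_sdiff_le` the trivial probability bound `1` is used.
  set q : ℝ := if s < 1 / 2 ∧ 6 * s ≤ rate E #V j then
    1 - (rate E #V j - 6 * s) / (3 + rate E #V j) else 1 with hq
  have hq0 : 0 ≤ q := by
    rw [hq]; split_ifs with h
    · rw [sub_nonneg, div_le_one (by linarith)]; linarith
    · norm_num
  have hq1 : q ≤ 1 := by
    rw [hq]; split_ifs with h
    · have : 0 ≤ (rate E #V j - 6 * s) / (3 + rate E #V j) :=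
        div_nonneg (by linarith [h.2]) (by linarith)
      linarith
    · exact le_rfl
  have hqf : 1 ≤ j → ∀ T ⊆ V, #T = 3 →
      (free E (V \ T) (j - 1) : ℝ) ≤ q * (#V - 3).choose (j - 1) := by
    intro hj1 T hT hT3
    rw [hq]; split_ifs with h
    · exact free_sdiff_le hE hM hj hj1 h2j (by linarith) h.1 h.2 (by linarith)
        (hs2 hM (by linarith))
    · have := free_le_choose (E := E) (V := V \ T) (j - 1)
      rw [card_sdiff_of_subset hT, hT3] at this
      rw [one_mul]; exact_mod_cast this
  have hup := le_of_le_deriv hr0 (hasDerivAt_genFun hE) hφ1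
    fun t ht0 ht1 => le_deriv_genFun hE hj hM hq0 hqf ht0 ht1
  rw [hφ0] at hup
  have hup2 := upper_error_le (y := excess E #V j / 2) (s := s) (q := q) hr0 (by linarith) hs0
    (by linarith) (fun h1 h2 => by rw [hq, if_pos ⟨h1, h2⟩]) hq1
  rw [mul_div_cancel₀ _ (two_ne_zero' ℝ)] at hup2
  have hup3 := hup2.trans (min_le_min hd (mul_le_mul_of_nonneg_left hd hr))
  have hu1 := hup3.trans (min_le_left _ _)
  have hu2 := hup3.trans (min_le_right _ _)
  have hg1 := mul_le_mul_of_nonneg_left g1 hd0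
  have hg2 := mul_le_mul_of_nonneg_left g2 hd0
  have hdr := mul_nonneg hr hd0
  exact le_min (abs_le.2 ⟨by linarith, by linarith⟩) (abs_le.2 ⟨by linarith, by linarith⟩)

end PairCount

/-! ### Graphs given by a relation; overlaps through degrees. -/

namespace PairCount

variable {α : Type*} [DecidableEq α]

/-- The pairs of distinct elements of `V` related by `r`. -/
def relatedPairs (r : α → α → Prop) [DecidableRel r] (V : Finset α) : Finset (Finset α) :=
  {e ∈ V.powersetCard 2 | ∃ x ∈ e, ∃ y ∈ e, x ≠ y ∧ r x y}

section

variable (r : α → α → Prop) [DecidableRel r] (V : Finset α)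

theorem relatedPairs_subset : relatedPairs r V ⊆ V.powersetCard 2 := filter_subset _ _

theorem free_relatedPairs (k : ℕ) : free (relatedPairs r V) V k
    = #{P ∈ V.powersetCard k | ∀ x ∈ P, ∀ y ∈ P, x ≠ y → ¬ r x y} := by
  unfold free
  congr 1
  refine filter_congr fun P hP => ?_
  have hPV := (mem_powersetCard.1 hP).1
  rw [inside, card_eq_zero, filter_eq_empty_iff]
  constructor
  · intro h x hx y hy hxy hr
    have hs : ({x, y} : Finset α) ⊆ P := by
      simp [insert_subset_iff, hx, hy]
    refine h (x := {x, y}) (mem_filter.2 ⟨mem_powersetCard.2 ⟨hs.trans hPV, card_pair hxy⟩,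
      x, by simp, y, by simp, hxy, hr⟩) hs
  · intro h e he hs
    obtain ⟨-, x, hx, y, hy, hxy, hr⟩ := mem_filter.1 he
    exact h x (hs hx) y (hs hy) hxy hr

variable {r}

theorem card_relatedPairs_mem (hr : ∀ x y, r x y → r y x) {x : α} (hx : x ∈ V) :
    #{e ∈ relatedPairs r V | x ∈ e} = #{y ∈ V | y ≠ x ∧ r x y} := by
  symm
  refine card_bij (fun y _ => {x, y}) ?_ ?_ ?_
  · intro y hy
    obtain ⟨hyV, hne, hr'⟩ := mem_filter.1 hy
    refine mem_filter.2 ⟨mem_filter.2 ⟨mem_powersetCard.2 ⟨?_, card_pair hne.symm⟩,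
      x, by simp, y, by simp, hne.symm, hr'⟩, by simp⟩
    simp [insert_subset_iff, hx, hyV]
  · intro y hy z hz h
    have h1 : y ∈ ({x, z} : Finset α) := h ▸ (by simp)
    simp only [mem_insert, mem_singleton] at h1
    exact h1.resolve_left (mem_filter.1 hy).2.1
  · intro e he
    obtain ⟨he, hxe⟩ := mem_filter.1 he
    obtain ⟨he, u, hu, v, hv, huv, huv'⟩ := mem_filter.1 he
    obtain ⟨heV, he2⟩ := mem_powersetCard.1 he
    have e1 : e = {u, v} := (eq_of_subset_of_card_le (by simp [insert_subset_iff, hu, hv])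
      (by rw [card_pair huv, he2])).symm
    rw [e1] at hxe
    simp only [mem_insert, mem_singleton] at hxe
    rcases hxe with rfl | rfl
    · exact ⟨v, mem_filter.2 ⟨heV hv, huv.symm, huv'⟩, e1.symm⟩
    · exact ⟨u, mem_filter.2 ⟨heV hu, huv, hr _ _ huv'⟩, by rw [e1, pair_comm]⟩

end

theorem sum_degree {V : Finset α} {E : Finset (Finset α)} (hE : E ⊆ V.powersetCard 2) :
    ∑ x ∈ V, #{e ∈ E | x ∈ e} = 2 * #E := by
  simp_rw [card_filter]
  rw [sum_comm, mul_comm, ← smul_eq_mul, ← sum_const]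
  refine sum_congr rfl fun e he => ?_
  obtain ⟨h1, h2⟩ := mem_powersetCard.1 (hE he)
  rw [← card_filter, filter_mem_eq_inter, inter_eq_right.2 h1, h2]

/-- Two distinct pairs that meet share exactly one point, so ordered overlaps are counted by their
common point. -/
theorem overlaps_eq {V : Finset α} {E : Finset (Finset α)} (hE : E ⊆ V.powersetCard 2) :
    (overlaps E : ℝ) = ∑ x ∈ V, (#{e ∈ E | x ∈ e} : ℝ) * (#{e ∈ E | x ∈ e} - 1) := by
  have h1 : ∀ a ∈ E, #(meeting E a) = ∑ x ∈ V with x ∈ a, #{e ∈ E | e ≠ a ∧ x ∈ e} := by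
    intro a ha
    have hcomm : ∑ x ∈ V with x ∈ a, #{e ∈ E | e ≠ a ∧ x ∈ e}
        = ∑ e ∈ E with e ≠ a, #(e ∩ a) := by
      simp_rw [← filter_filter, card_filter _ (filter _ E)]
      rw [sum_comm]
      refine sum_congr rfl fun e he => ?_
      rw [← card_filter, filter_filter]
      congr 1
      ext x
      simp only [mem_filter, mem_inter]
      exact ⟨fun h => ⟨h.2.2, h.2.1⟩,
        fun h => ⟨(mem_powersetCard.1 (hE ha)).1 h.2, h.2, h.1⟩⟩
    rw [hcomm, meeting, card_eq_sum_ones]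
    refine (sum_congr rfl fun e he => (card_inter_eq_one hE ha he).symm).trans
      (sum_subset (fun e he => ?_) fun e he hne => ?_)
    · exact mem_filter.2 ⟨(mem_filter.1 he).1, (mem_filter.1 he).2.1⟩
    · rw [card_eq_zero, ← disjoint_iff_inter_eq_empty]
      by_contra hd
      exact hne (mem_filter.2 ⟨(mem_filter.1 he).1, (mem_filter.1 he).2, hd⟩)
  have h2 : (overlaps E : ℝ)
      = ∑ a ∈ E, ∑ x ∈ V with x ∈ a, ((#{e ∈ E | x ∈ e} : ℝ) - 1) := by
    rw [overlaps, sum_congr rfl h1]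
    push_cast
    refine sum_congr rfl fun a ha => sum_congr rfl fun x hx => ?_
    have h3 : {e ∈ E | e ≠ a ∧ x ∈ e} = ({e ∈ E | x ∈ e}).erase a := by
      ext e; simp only [mem_filter, mem_erase]; tauto
    have h4 : a ∈ {e ∈ E | x ∈ e} := mem_filter.2 ⟨ha, (mem_filter.1 hx).2⟩
    rw [h3, card_erase_of_mem h4, Nat.cast_sub (card_pos.2 ⟨a, h4⟩), Nat.cast_one]
  rw [h2, sum_comm' (t' := V) (s' := fun x => {a ∈ E | x ∈ a})]
  · refine sum_congr rfl fun x _ => ?_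
    rw [sum_const, nsmul_eq_mul]
  · intro a x; simp only [mem_filter]; tauto

end PairCount

/-! ### The board parameters as sums over squares. -/

namespace FerrersBoard

variable (B : YoungDiagram)

theorem sum_cells_rows (F : ℕ × ℕ → ℝ) :
    ∑ c ∈ B.cells, F c = ∑ i ∈ range (B.colLen 0), ∑ j ∈ range (B.rowLen i), F (i, j) := by
  rw [sum_sigma']
  refine sum_bij' (fun c _ => ⟨c.1, c.2⟩) (fun s _ => (s.1, s.2)) ?_ ?_ ?_ ?_ ?_
  · rintro ⟨i, j⟩ h
    rw [YoungDiagram.mem_cells] at h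
    simp only [mem_sigma, mem_range]
    exact ⟨YoungDiagram.mem_iff_lt_colLen.1 (B.up_left_mem le_rfl (Nat.zero_le _) h),
      YoungDiagram.mem_iff_lt_rowLen.1 h⟩
  · rintro ⟨i, j⟩ h
    simp only [mem_sigma, mem_range] at h
    exact (YoungDiagram.mem_cells _).2 (YoungDiagram.mem_iff_lt_rowLen.2 h.2)
  all_goals simp

theorem sum_cells_cols (F : ℕ × ℕ → ℝ) :
    ∑ c ∈ B.cells, F c = ∑ j ∈ range (B.rowLen 0), ∑ i ∈ range (B.colLen j), F (i, j) := by
  rw [sum_sigma']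
  refine sum_bij' (fun c _ => ⟨c.2, c.1⟩) (fun s _ => (s.2, s.1)) ?_ ?_ ?_ ?_ ?_
  · rintro ⟨i, j⟩ h
    rw [YoungDiagram.mem_cells] at h
    simp only [mem_sigma, mem_range]
    exact ⟨YoungDiagram.mem_iff_lt_rowLen.1 (B.up_left_mem (Nat.zero_le _) le_rfl h),
      YoungDiagram.mem_iff_lt_colLen.1 h⟩
  · rintro ⟨i, j⟩ h
    simp only [mem_sigma, mem_range] at h
    exact (YoungDiagram.mem_cells _).2 (YoungDiagram.mem_iff_lt_colLen.2 h.2)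
  all_goals simp

theorem size_eq_card : size B = #B.cells := by
  have := sum_cells_rows B fun _ => 1
  simp only [sum_const, card_range, nsmul_eq_mul, mul_one] at this
  unfold size
  exact_mod_cast this.symm

theorem sum_rowLen_sub_one : ∑ c ∈ B.cells, ((B.rowLen c.1 : ℝ) - 1) = 2 * rowPairs B := by
  rw [sum_cells_rows, rowPairs]
  push_cast
  rw [mul_sum]
  refine sum_congr rfl fun i _ => ?_
  rw [sum_const, card_range, nsmul_eq_mul, Nat.cast_choose_two]
  ring

theorem sum_colLen_sub_one : ∑ c ∈ B.cells, ((B.colLen c.2 : ℝ) - 1) = 2 * colPairs B := by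
  rw [sum_cells_cols, colPairs]
  push_cast
  rw [mul_sum]
  refine sum_congr rfl fun i _ => ?_
  rw [sum_const, card_range, nsmul_eq_mul, Nat.cast_choose_two]
  ring

/-- Each index lies in `b - 1` of the pairs. -/
theorem sum_Ioo_pairs (b : ℕ) (x : ℕ → ℝ) :
    ∑ c₁ ∈ range b, ∑ c₂ ∈ Ioo c₁ b, (x c₁ + x c₂) = (b - 1) * ∑ c ∈ range b, x c := by
  induction b with
  | zero => simp
  | succ b ih =>
    rw [sum_range_succ, sum_range_succ _ b]
    have h1 : ∀ c₁ ∈ range b, ∑ c₂ ∈ Ioo c₁ (b + 1), (x c₁ + x c₂)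
        = ∑ c₂ ∈ Ioo c₁ b, (x c₁ + x c₂) + (x c₁ + x b) := by
      intro c hc
      have : Ioo c (b + 1) = insert b (Ioo c b) := by
        ext z
        simp only [mem_Ioo, mem_insert, mem_range] at hc ⊢
        omega
      rw [this, sum_insert (by simp), add_comm]
    have h2 : Ioo b (b + 1) = ∅ := by ext z; simp only [mem_Ioo, notMem_empty, iff_false]; omega
    rw [sum_congr rfl h1, sum_add_distrib, ih, h2, sum_empty, sum_add_distrib, sum_const,
      card_range, nsmul_eq_mul]
    push_cast; ring

theorem s2_eq (k : ℕ) : s2 B k = (k - 2) / (size B - 2)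
    * ((∑ c ∈ B.cells, ((B.rowLen c.1 : ℝ) - 1) * (B.rowLen c.1 - 2)) / 2) := by
  rw [s2, sum_cells_rows, div_mul_eq_mul_div, mul_div_assoc, sum_div, sum_div]
  congr 1
  refine sum_congr rfl fun i _ => ?_
  dsimp only
  rw [sum_const, card_range, nsmul_eq_mul, Nat.cast_choose_two]
  ring

theorem s2'_eq (k : ℕ) : s2' B k = (k - 2) / (size B - 2)
    * ((∑ c ∈ B.cells, ((B.colLen c.2 : ℝ) - 1) * (B.colLen c.2 - 2)) / 2) := by
  rw [s2', sum_cells_cols, div_mul_eq_mul_div, mul_div_assoc, sum_div, sum_div]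
  congr 1
  refine sum_congr rfl fun i _ => ?_
  dsimp only
  rw [sum_const, card_range, nsmul_eq_mul, Nat.cast_choose_two]
  ring

/-- The sum over squares is symmetric in rows and columns, so `s3` and `s3'` coincide. -/
theorem s3_eq (k : ℕ) : s3 B k = (k - 2) / (size B - 2)
    * ∑ c ∈ B.cells, ((B.rowLen c.1 : ℝ) - 1) * (B.colLen c.2 - 1) := by
  rw [s3, sum_cells_rows, div_mul_eq_mul_div, mul_div_assoc, sum_div]
  congr 1
  refine sum_congr rfl fun i _ => ?_
  dsimp only
  rw [sum_Ioo_pairs _ fun c => ((B.colLen c : ℝ) - 1) / (size B - 2), ← mul_sum, ← sum_div,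
    mul_div_assoc]

theorem s3'_eq (k : ℕ) : s3' B k = (k - 2) / (size B - 2)
    * ∑ c ∈ B.cells, ((B.rowLen c.1 : ℝ) - 1) * (B.colLen c.2 - 1) := by
  rw [s3', sum_cells_cols, div_mul_eq_mul_div, mul_div_assoc, sum_div]
  congr 1
  refine sum_congr rfl fun i _ => ?_
  dsimp only
  rw [sum_Ioo_pairs _ fun c => ((B.rowLen c : ℝ) - 1) / (size B - 2), ← sum_mul, ← sum_div]
  ring


/-- Two squares of a board attack each other as rooks. -/
def Attack (x y : ℕ × ℕ) : Prop := x.1 = y.1 ∨ x.2 = y.2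

/-- Two squares of a board lie in the same column. -/
def SameColumn (x y : ℕ × ℕ) : Prop := x.2 = y.2

instance : DecidableRel Attack := fun x y => inferInstanceAs (Decidable (x.1 = y.1 ∨ x.2 = y.2))

instance : DecidableRel SameColumn := fun x y => inferInstanceAs (Decidable (x.2 = y.2))

/-! ### The attack and same-column graphs of a board. -/

open PairCount

theorem rookNumber_eq_free (k : ℕ) :
    rookNumber B k = free (relatedPairs Attack B.cells) B.cells k := by
  rw [free_relatedPairs, rookNumber]
  exact congrArg card (filter_congr fun P _ => by simp only [Attack, not_or, ne_eq])

theorem fileNumber_eq_free (k : ℕ) :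
    fileNumber B k = free (relatedPairs SameColumn B.cells) B.cells k := by
  rw [free_relatedPairs, fileNumber]
  exact congrArg card (filter_congr fun P _ => Iff.rfl)

theorem card_sameColumn {c : ℕ × ℕ} (hc : c ∈ B.cells) :
    #{y ∈ B.cells | y ≠ c ∧ SameColumn c y} = B.colLen c.2 - 1 := by
  have e : {y ∈ B.cells | y ≠ c ∧ SameColumn c y} = (B.col c.2).erase c := by
    ext y
    rw [mem_filter]
    simp only [SameColumn, mem_erase, YoungDiagram.mem_col_iff, YoungDiagram.mem_cells]
    constructor
    · rintro ⟨h, h1, h2⟩; exact ⟨h1, h, h2.symm⟩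
    · rintro ⟨h1, h, h2⟩; exact ⟨h, h1, h2.symm⟩
  rw [e, card_erase_of_mem (YoungDiagram.mem_col_iff.2 ⟨(YoungDiagram.mem_cells c).1 hc, rfl⟩),
    B.colLen_eq_card]

theorem card_attack {c : ℕ × ℕ} (hc : c ∈ B.cells) :
    #{y ∈ B.cells | y ≠ c ∧ Attack c y} = (B.rowLen c.1 - 1) + (B.colLen c.2 - 1) := by
  have e : {y ∈ B.cells | y ≠ c ∧ Attack c y} = (B.row c.1).erase c ∪ (B.col c.2).erase c := by
    ext y
    simp only [Attack, mem_filter, mem_erase, mem_union, YoungDiagram.mem_col_iff,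
      YoungDiagram.mem_row_iff, YoungDiagram.mem_cells, eq_comm (a := c.1), eq_comm (a := c.2)]
    tauto
  have hd : Disjoint ((B.row c.1).erase c) ((B.col c.2).erase c) := by
    rw [disjoint_left]
    intro y hy hy'
    simp only [mem_erase, YoungDiagram.mem_col_iff, YoungDiagram.mem_row_iff] at hy hy'
    exact hy.1 (Prod.ext hy.2.2 hy'.2.2)
  have hc' := (YoungDiagram.mem_cells c).1 hc
  rw [e, card_union_of_disjoint hd, card_erase_of_mem (YoungDiagram.mem_col_iff.2 ⟨hc', rfl⟩),
    card_erase_of_mem (YoungDiagram.mem_row_iff.2 ⟨hc', rfl⟩), B.colLen_eq_card, B.rowLen_eq_card]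

theorem rowLen_pos {c : ℕ × ℕ} (hc : c ∈ B.cells) : 1 ≤ B.rowLen c.1 :=
  (Nat.zero_le _).trans_lt (YoungDiagram.mem_iff_lt_rowLen.1 ((YoungDiagram.mem_cells c).1 hc))

theorem colLen_pos {c : ℕ × ℕ} (hc : c ∈ B.cells) : 1 ≤ B.colLen c.2 :=
  (Nat.zero_le _).trans_lt (YoungDiagram.mem_iff_lt_colLen.1 ((YoungDiagram.mem_cells c).1 hc))

theorem sameColumn_degree {c : ℕ × ℕ} (hc : c ∈ B.cells) :
    (#{e ∈ relatedPairs SameColumn B.cells | c ∈ e} : ℝ) = (B.colLen c.2 : ℝ) - 1 := by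
  rw [card_relatedPairs_mem (r := SameColumn) B.cells (fun _ _ h => Eq.symm h) hc, card_sameColumn B hc,
    Nat.cast_sub (colLen_pos B hc), Nat.cast_one]

theorem attack_degree {c : ℕ × ℕ} (hc : c ∈ B.cells) :
    (#{e ∈ relatedPairs Attack B.cells | c ∈ e} : ℝ)
      = ((B.rowLen c.1 : ℝ) - 1) + ((B.colLen c.2 : ℝ) - 1) := by
  rw [card_relatedPairs_mem B.cells (fun _ _ h => h.imp Eq.symm Eq.symm) hc, card_attack B hc,
    Nat.cast_add, Nat.cast_sub (colLen_pos B hc), Nat.cast_sub (rowLen_pos B hc), Nat.cast_one]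

theorem card_sameColumn_pairs :
    (#(relatedPairs SameColumn B.cells) : ℝ) = colPairs B := by
  have h := sum_degree (relatedPairs_subset SameColumn B.cells)
  have h' : ∑ c ∈ B.cells, (#{e ∈ relatedPairs SameColumn B.cells | c ∈ e} : ℝ)
      = 2 * #(relatedPairs SameColumn B.cells) := by exact_mod_cast h
  rw [sum_congr rfl fun c hc => sameColumn_degree B hc, sum_colLen_sub_one] at h'
  linarith

theorem card_attack_pairs :
    (#(relatedPairs Attack B.cells) : ℝ) = rowPairs B + colPairs B := by
  have h := sum_degree (relatedPairs_subset Attack B.cells)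
  have h' : ∑ c ∈ B.cells, (#{e ∈ relatedPairs Attack B.cells | c ∈ e} : ℝ)
      = 2 * #(relatedPairs Attack B.cells) := by exact_mod_cast h
  rw [sum_congr rfl fun c hc => attack_degree B hc, sum_add_distrib, sum_colLen_sub_one,
    sum_rowLen_sub_one] at h'
  linarith

theorem overlaps_sameColumn (k : ℕ) :
    (k - 2) / (size B - 2) * ((overlaps (relatedPairs SameColumn B.cells) : ℝ) / 2) = s2' B k := by
  rw [overlaps_eq (relatedPairs_subset SameColumn B.cells), s2'_eq]
  congr 2
  refine sum_congr rfl fun c hc => ?_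
  rw [sameColumn_degree B hc]; ring

/-- With `p` and `q` the other squares in the row and column of a square, its degree is `p + q`, and
`(p+q)(p+q-1) = p(p-1) + q(q-1) + 2pq` separates `s2`, `s2'` and `s3`. -/
theorem overlaps_attack (k : ℕ) :
    (k - 2) / (size B - 2) * ((overlaps (relatedPairs Attack B.cells) : ℝ) / 2)
      = s2 B k + s2' B k + s3 B k := by
  rw [overlaps_eq (relatedPairs_subset Attack B.cells), s2_eq, s2'_eq, s3_eq, ← mul_add, ← mul_add,
    ← add_div, ← sum_add_distrib, sum_div, sum_div, ← sum_add_distrib]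
  congr 1
  refine sum_congr rfl fun c hc => ?_
  rw [attack_degree B hc]; ring

theorem corner_sum_nonneg :
    0 ≤ ∑ c ∈ B.cells, ((B.rowLen c.1 : ℝ) - 1) * (B.colLen c.2 - 1) := by
  refine sum_nonneg fun c hc => ?_
  have h1 : (1 : ℝ) ≤ B.rowLen c.1 := by exact_mod_cast rowLen_pos B hc
  have h2 : (1 : ℝ) ≤ B.colLen c.2 := by exact_mod_cast colLen_pos B hc
  nlinarith

/-! ### Lower bounds on the numbers of pairs. -/

theorem size_eq_sum_colLen : size B = ∑ j ∈ range (B.rowLen 0), B.colLen j := by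
  have := sum_cells_cols B fun _ => 1
  simp only [sum_const, card_range, nsmul_eq_mul, mul_one] at this
  rw [size_eq_card]
  exact_mod_cast this

theorem le_choose_two_add_one (n : ℕ) : n ≤ n.choose 2 + 1 := by
  rcases n with _ | n
  · omega
  · rw [Nat.choose_succ_succ' n 1, Nat.choose_one_right]; omega

theorem size_le_add_rowPairs : size B ≤ rowPairs B + B.colLen 0 := by
  unfold size rowPairs
  calc ∑ i ∈ range (B.colLen 0), B.rowLen i
      ≤ ∑ i ∈ range (B.colLen 0), ((B.rowLen i).choose 2 + 1) :=
        sum_le_sum fun i _ => le_choose_two_add_one _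
    _ = _ := by rw [sum_add_distrib]; simp

theorem size_le_add_colPairs : size B ≤ colPairs B + B.rowLen 0 := by
  rw [size_eq_sum_colLen]
  unfold colPairs
  calc ∑ i ∈ range (B.rowLen 0), B.colLen i
      ≤ ∑ i ∈ range (B.rowLen 0), ((B.colLen i).choose 2 + 1) :=
        sum_le_sum fun i _ => le_choose_two_add_one _
    _ = _ := by rw [sum_add_distrib]; simp

theorem colLen_zero_choose_le (h : 0 < B.rowLen 0) : (B.colLen 0).choose 2 ≤ colPairs B :=
  single_le_sum (f := fun j => (B.colLen j).choose 2) (fun _ _ => Nat.zero_le _) (mem_range.2 h)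

theorem rowLen_zero_pos (h : 0 < size B) : 0 < B.rowLen 0 := by
  rw [size_eq_card, card_pos] at h
  obtain ⟨c, hc⟩ := h
  have := (YoungDiagram.mem_cells c).1 hc
  exact (Nat.zero_le _).trans_lt
    (YoungDiagram.mem_iff_lt_rowLen.1 (B.up_left_mem (i1 := 0) (j1 := c.2) (Nat.zero_le _) le_rfl this))

/-- The rook graph of a Ferrers board is connected, so it has at least `N - 1` edges. -/
theorem size_le_pairs_add_one (h : 0 < size B) : size B ≤ rowPairs B + colPairs B + 1 := by
  have h1 := size_le_add_rowPairs B
  have h2 := le_choose_two_add_one (B.colLen 0)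
  have h3 := colLen_zero_choose_le B (rowLen_zero_pos B h)
  omega

/-- In column `j` the top row alone contributes `b_1 - 1 ≥ b'_1 ≥ b'_{j+1}` to the sum of `rowLen -
1`. -/
theorem colPairs_le_corner_sum (h : B.colLen 0 + 1 ≤ B.rowLen 0) :
    2 * (colPairs B : ℝ) ≤ ∑ c ∈ B.cells, ((B.rowLen c.1 : ℝ) - 1) * (B.colLen c.2 - 1) := by
  rw [sum_cells_cols, colPairs]
  push_cast
  rw [mul_sum]
  refine sum_le_sum fun j hj => ?_
  rcases Nat.eq_zero_or_pos (B.colLen j) with h0 | h0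
  · simp [h0]
  have hc : ∀ i ∈ range (B.colLen j), (1 : ℝ) ≤ B.rowLen i := fun i hi => by
    exact_mod_cast rowLen_pos B (c := (i, j))
      ((YoungDiagram.mem_cells _).2 (YoungDiagram.mem_iff_lt_colLen.2 (mem_range.1 hi)))
  have h1 : (1 : ℝ) ≤ B.colLen j := by exact_mod_cast h0
  rw [← sum_mul]
  have h2 : (B.colLen j : ℝ) ≤ ∑ i ∈ range (B.colLen j), ((B.rowLen i : ℝ) - 1) := by
    have h3 := single_le_sum (f := fun i => (B.rowLen i : ℝ) - 1)
      (fun i hi => sub_nonneg.2 (hc i hi)) (mem_range.2 h0)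
    have h4 : (B.colLen j : ℝ) + 1 ≤ B.rowLen 0 := by
      have := B.colLen_anti 0 j (Nat.zero_le _)
      exact_mod_cast (by omega : B.colLen j + 1 ≤ B.rowLen 0)
    linarith
  rw [Nat.cast_choose_two]
  nlinarith

/-- The number of columns is at most `colLen 0`, which is at most `(colLen 0).choose 2 ≤ L'` once
`colLen 0 ≥ 3`. Otherwise the board fits in a `2 × 2` square. -/
theorem size_le_two_mul_colPairs (h : B.rowLen 0 ≤ B.colLen 0) (h0 : 0 < size B) :
    size B ≤ 2 * colPairs B ∨ size B ≤ 4 := by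
  have h1 := size_le_add_colPairs B
  have h2 := colLen_zero_choose_le B (rowLen_zero_pos B h0)
  rcases Nat.lt_or_ge (B.colLen 0) 3 with h3 | h3
  · right
    rw [size_eq_sum_colLen]
    calc ∑ j ∈ range (B.rowLen 0), B.colLen j ≤ ∑ j ∈ range (B.rowLen 0), 2 :=
          sum_le_sum fun j _ => (B.colLen_anti 0 j (Nat.zero_le _)).trans (by omega)
      _ ≤ 4 := by simp; omega
  · left
    have h4 : B.colLen 0 ≤ (B.colLen 0).choose 2 := by
      obtain ⟨n, hn⟩ : ∃ n, B.colLen 0 = n + 3 := ⟨B.colLen 0 - 3, by omega⟩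
      rw [hn, Nat.choose_succ_succ' (n + 2) 1, Nat.choose_one_right,
        Nat.choose_succ_succ' (n + 1) 1, Nat.choose_one_right]
      omega
    omega

theorem bounds_of_abs_sub_le {c p r R x : ℝ} (hc : 0 < c) (h : |p / c - Real.exp (-x)| ≤ R)
    (hr : r = x) :
    c * Real.exp (-r) * (1 - Real.exp r * R) ≤ p ∧ p ≤ c * Real.exp (-r) * (1 + Real.exp r * R) := by
  subst hr
  obtain ⟨h1, h2⟩ := abs_le.1 h
  have e : Real.exp (-r) * Real.exp r = 1 := by rw [← Real.exp_add]; simp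
  have e1 : c * Real.exp (-r) * (1 - Real.exp r * R) = c * (Real.exp (-r) - R) := by
    linear_combination (-c * R) * e
  have e2 : c * Real.exp (-r) * (1 + Real.exp r * R) = c * (Real.exp (-r) + R) := by
    linear_combination (c * R) * e
  have e3 : p = c * (p / c) := by field_simp
  rw [e1, e2]
  constructor
  · rw [e3]; exact mul_le_mul_of_nonneg_left (by linarith) hc.le
  · rw [e3]; exact mul_le_mul_of_nonneg_left (by linarith) hc.le

end FerrersBoard

/-! ### Application to rook and file numbers. -/

namespace FerrersBoard

open PairCount

theorem rook_bounds (B : YoungDiagram) {j : ℕ} (hj : j + 2 ≤ size B) :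
    |(rookNumber B (j + 2) : ℝ) / (size B).choose (j + 2)
        - Real.exp (-(rowRate B (j + 2) + colRate B (j + 2)))| ≤ rookError B (j + 2) := by
  have hj' : j + 2 ≤ #B.cells := size_eq_card B ▸ hj
  have hN2 : (2 : ℝ) ≤ size B := by exact_mod_cast (by omega : 2 ≤ size B)
  have hNj : (j : ℝ) + 2 ≤ size B := by exact_mod_cast hj
  have hj0 : (0 : ℝ) ≤ j := j.cast_nonneg
  have hN0 : (0 : ℝ) ≤ size B - 2 := by linarith
  have hr : rate (relatedPairs Attack B.cells) #B.cells j
      = rowRate B (j + 2) + colRate B (j + 2) := by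
    rw [rate, rowRate, colRate, card_attack_pairs, ← size_eq_card, Nat.cast_choose_two,
      Nat.cast_choose_two, ← add_div, ← mul_add]
    push_cast
    field_simp
    ring
  have hw := s3_eq B (j + 2)
  have hw' := s3'_eq B (j + 2)
  have ho := overlaps_attack B (j + 2)
  have hcorner := corner_sum_nonneg B
  push_cast at hw hw' ho
  rw [add_sub_cancel_right] at hw hw' ho
  have hs3 : 0 ≤ s3' B (j + 2) := by rw [hw']; positivity
  have he : excess (relatedPairs Attack B.cells) #B.cells j / 2
      = (s2 B (j + 2) + s2' B (j + 2) + s3 B (j + 2)) / (rowPairs B + colPairs B) := by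
    rw [← ho, excess, card_attack_pairs, ← size_eq_card, mul_comm ((size B : ℝ) - 2), ← div_div]
    ring
  have key := abs_free_sub_exp_le (relatedPairs_subset Attack B.cells) hj'
    (d := d3 B (j + 2))
    -- This is `s0 + s0' + s1 + s1' + s4`, as `13 - 12 k + 3 k² = 3 (k - 2)² + 1`. The `s3'` part of
    -- `d3` is not needed.
    (s := (2 * j + 1) * (rowPairs B + colPairs B) / ((size B).choose 2 : ℝ)
      + (3 * j ^ 2 + 1) / ((size B).choose 2 : ℝ))
    (by rw [card_attack_pairs, ← size_eq_card])
    (fun _ _ => by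
      rw [← size_eq_card, add_comm]
      refine add_le_add_left ?_ _
      -- For `N = 2` the quotient by `N - 2` is `0` by convention.
      rcases eq_or_lt_of_le hN2 with h2 | h2
      · rw [← h2]; simp; positivity
      have hM : (size B : ℝ) ≤ rowPairs B + colPairs B + 1 := by
        exact_mod_cast size_le_pairs_add_one B (by omega)
      rw [Nat.cast_choose_two, mul_div_assoc', div_le_div_iff₀ (by linarith) (by nlinarith)]
      have h3 : (size B : ℝ) * (size B - 1) / 2 * 2
          ≤ size B * (rowPairs B + colPairs B) := by nlinarith
      have h4 : ((j : ℝ) - 1) * size B ≤ (2 * j + 1) * (size B - 2) := by nlinarith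
      have h5 : (0 : ℝ) ≤ rowPairs B + colPairs B := by positivity
      rcases le_or_gt 1 (j : ℝ) with h6 | h6
      · have h7 := mul_le_mul_of_nonneg_left h3 (by linarith : (0 : ℝ) ≤ j - 1)
        have h8 := mul_le_mul_of_nonneg_right h4 h5
        linarith
      · have h7 : 0 ≤ (2 * (j : ℝ) + 1) * (rowPairs B + colPairs B) * (size B - 2) := by positivity
        have h8 : 0 ≤ (size B : ℝ) * (size B - 1) / 2 := by nlinarith
        nlinarith)
    (by
      rw [he, d3, s0, s0', s1, s1', s4, add_div _ (s3' B (j + 2))]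
      have h1 : 0 ≤ s3' B (j + 2) / (rowPairs B + colPairs B) := by positivity
      push_cast
      have e : (2 * j + 1) * ((rowPairs B : ℝ) + colPairs B) / ((size B).choose 2 : ℝ)
          + (3 * j ^ 2 + 1) / ((size B).choose 2 : ℝ)
          = rowPairs B / ((size B).choose 2 : ℝ) + colPairs B / ((size B).choose 2 : ℝ)
          + 2 * (j + 2 - 2) * rowPairs B / ((size B).choose 2 : ℝ)
          + 2 * (j + 2 - 2) * colPairs B / ((size B).choose 2 : ℝ)
          + (13 - 12 * (j + 2) + 3 * (j + 2) ^ 2) / ((size B).choose 2 : ℝ) := by ring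
      linarith)
  rw [← rookNumber_eq_free, hr, ← size_eq_card] at key
  exact key

theorem file_bounds (B : YoungDiagram) {j : ℕ} (hj : j + 2 ≤ size B) :
    |(fileNumber B (j + 2) : ℝ) / (size B).choose (j + 2) - Real.exp (-colRate B (j + 2))|
      ≤ fileError B (j + 2) := by
  have hj' : j + 2 ≤ #B.cells := size_eq_card B ▸ hj
  have hN2 : (2 : ℝ) ≤ size B := by exact_mod_cast (by omega : 2 ≤ size B)
  have hNj : (j : ℝ) + 2 ≤ size B := by exact_mod_cast hj
  have hj0 : (0 : ℝ) ≤ j := j.cast_nonneg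
  have hN0 : (0 : ℝ) ≤ size B - 2 := by linarith
  have hr : rate (relatedPairs SameColumn B.cells) #B.cells j = colRate B (j + 2) := by
    rw [rate, colRate, card_sameColumn_pairs, ← size_eq_card, Nat.cast_choose_two,
      Nat.cast_choose_two]
    push_cast
    field_simp
    ring
  have hw' := s3'_eq B (j + 2)
  have ho := overlaps_sameColumn B (j + 2)
  have hcorner := corner_sum_nonneg B
  push_cast at hw' ho
  rw [add_sub_cancel_right] at hw' ho
  have hs3 : 0 ≤ s3' B (j + 2) := by rw [hw']; positivity
  have hs3d : 0 ≤ s3' B (j + 2) / colPairs B := by positivity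
  have hs1 : (0 : ℝ) ≤ (2 * j + 1) * colPairs B / ((size B).choose 2 : ℝ) := by positivity
  have he : excess (relatedPairs SameColumn B.cells) #B.cells j / 2
      = s2' B (j + 2) / colPairs B := by
    rw [← ho, excess, card_sameColumn_pairs, ← size_eq_card, mul_comm ((size B : ℝ) - 2), ← div_div]
    ring
  have key := abs_free_sub_exp_le (relatedPairs_subset SameColumn B.cells) hj'
    (d := d4 B (j + 2))
    -- Here `s3'` is kept in `s`, since there may be too few same-column pairs.
    (s := (2 * j + 1) * colPairs B / ((size B).choose 2 : ℝ)
      + (3 * j ^ 2 + 1) / ((size B).choose 2 : ℝ) + s3' B (j + 2) / colPairs B)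
    (by rw [card_sameColumn_pairs, ← size_eq_card]; linarith)
    (fun hM hs => by
      have hM' : (0 : ℝ) < colPairs B := by rw [← card_sameColumn_pairs]; exact_mod_cast hM
      rw [← size_eq_card]
      suffices h : 2 * (((j : ℝ) - 1) / (size B - 2))
          ≤ (2 * j + 1) * colPairs B / ((size B).choose 2 : ℝ) + s3' B (j + 2) / colPairs B by
        linarith
      rcases le_or_gt (j : ℝ) 1 with h1 | h1
      · have : ((j : ℝ) - 1) / (size B - 2) ≤ 0 := div_nonpos_of_nonpos_of_nonneg (by linarith) hN0
        linarith
      have hN2' : (0 : ℝ) < size B - 2 := by linarith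
      -- With more columns than rows `s3' / L'` absorbs the term; otherwise `N ≤ 2 L'` and `s0' +
      -- s1'` does, apart from boards with `N ≤ 4`.
      rcases Nat.lt_or_ge (B.colLen 0) (B.rowLen 0) with h2 | h2
      · have h3 := colPairs_le_corner_sum B h2
        have h4 : 2 * (((j : ℝ) - 1) / (size B - 2)) ≤ s3' B (j + 2) / colPairs B := by
          rw [hw', le_div_iff₀ hM']
          have h5 : ((j : ℝ) - 1) / (size B - 2) ≤ j / (size B - 2) := by gcongr; linarith
          have h6 : 0 ≤ (j : ℝ) / (size B - 2) := by positivity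
          calc 2 * (((j : ℝ) - 1) / (size B - 2)) * colPairs B
              ≤ 2 * (j / (size B - 2)) * colPairs B := by gcongr
            _ = j / (size B - 2) * (2 * colPairs B) := by ring
            _ ≤ _ := by gcongr
        linarith
      · rcases size_le_two_mul_colPairs B h2 (by omega) with h3 | h3
        · have h3' : (size B : ℝ) ≤ 2 * colPairs B := by exact_mod_cast h3
          have h4 : 2 * (((j : ℝ) - 1) / (size B - 2))
              ≤ (2 * j + 1) * colPairs B / ((size B).choose 2 : ℝ) := by
            rw [Nat.cast_choose_two, mul_div_assoc', div_le_div_iff₀ hN2' (by nlinarith)]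
            have h5 : 2 * ((j : ℝ) - 1) * (size B - 1) ≤ (2 * j + 1) * (size B - 2) := by nlinarith
            have h6 := mul_le_mul_of_nonneg_right h5 (Nat.cast_nonneg (α := ℝ) (size B))
            have h7 := mul_le_mul_of_nonneg_left h3'
              (by positivity : (0 : ℝ) ≤ (2 * j + 1) * (size B - 2))
            linarith
          linarith
        -- Only `j = 2`, `N = 4` remains, and there the `s4` term is `13/6`, against `s < 1`.
        · exfalso
          have h1' : 1 < j := by exact_mod_cast h1
          have e1 : j = 2 := by omega
          have e2 : size B = 4 := by omega
          rw [e2, e1] at hs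
          rw [e2, e1] at hs1
          rw [e1] at hs3d
          norm_num [Nat.choose] at hs hs1
          linarith)
    (by
      rw [he, d4, s0', s1', s4, add_div _ (s3' B (j + 2))]
      push_cast
      have e : (2 * j + 1) * (colPairs B : ℝ) / ((size B).choose 2 : ℝ)
          + (3 * j ^ 2 + 1) / ((size B).choose 2 : ℝ)
          = colPairs B / ((size B).choose 2 : ℝ)
          + 2 * (j + 2 - 2) * colPairs B / ((size B).choose 2 : ℝ)
          + (13 - 12 * (j + 2) + 3 * (j + 2) ^ 2) / ((size B).choose 2 : ℝ) := by ring
      linarith)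
  rw [← fileNumber_eq_free, hr, ← size_eq_card] at key
  exact key

end FerrersBoard

theorem mainTheorem4 (B : YoungDiagram) (k : ℕ) (hk : 2 ≤ k) :
    (((FerrersBoard.size B).choose k : ℝ)
          * Real.exp (-(FerrersBoard.rowRate B k + FerrersBoard.colRate B k))
          * (1 - Real.exp (FerrersBoard.rowRate B k + FerrersBoard.colRate B k)
              * FerrersBoard.rookError B k)
        ≤ (FerrersBoard.rookNumber B k : ℝ) ∧
      (FerrersBoard.rookNumber B k : ℝ)
        ≤ ((FerrersBoard.size B).choose k : ℝ)
          * Real.exp (-(FerrersBoard.rowRate B k + FerrersBoard.colRate B k))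
          * (1 + Real.exp (FerrersBoard.rowRate B k + FerrersBoard.colRate B k)
              * FerrersBoard.rookError B k)) ∧
    (((FerrersBoard.size B).choose k : ℝ)
          * Real.exp (-FerrersBoard.colRate B k)
          * (1 - Real.exp (FerrersBoard.colRate B k) * FerrersBoard.fileError B k)
        ≤ (FerrersBoard.fileNumber B k : ℝ) ∧
      (FerrersBoard.fileNumber B k : ℝ)
        ≤ ((FerrersBoard.size B).choose k : ℝ)
          * Real.exp (-FerrersBoard.colRate B k)
          * (1 + Real.exp (FerrersBoard.colRate B k) * FerrersBoard.fileError B k)) := by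
  obtain ⟨j, rfl⟩ : ∃ j, k = j + 2 := ⟨k - 2, by omega⟩
  -- With fewer than `k` squares every quantity compared is `0`.
  rcases Nat.lt_or_ge (FerrersBoard.size B) (j + 2) with h | h
  · have hc := Nat.choose_eq_zero_of_lt h
    have h1 := PairCount.free_le_choose
      (E := PairCount.relatedPairs FerrersBoard.Attack B.cells) (V := B.cells) (j + 2)
    have h2 := PairCount.free_le_choose
      (E := PairCount.relatedPairs FerrersBoard.SameColumn B.cells) (V := B.cells) (j + 2)
    rw [← FerrersBoard.rookNumber_eq_free, ← FerrersBoard.size_eq_card, hc, Nat.le_zero] at h1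
    rw [← FerrersBoard.fileNumber_eq_free, ← FerrersBoard.size_eq_card, hc, Nat.le_zero] at h2
    rw [h1, h2, hc]
    simp
  · have hC := PairCount.choose_pos_real h
    exact ⟨FerrersBoard.bounds_of_abs_sub_le hC (FerrersBoard.rook_bounds B h) rfl,
      FerrersBoard.bounds_of_abs_sub_le hC (FerrersBoard.file_bounds B h) rfl⟩
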